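/- \textbf{Conventions.} Let $\mathcal C$ be a category and $\mathcal A$ a set of morphisms of $\mathcal C$ (the \emph{basic morphisms}). A \emph{diagram} in $\mathcal C$ is a directed graph (loops and parallel edges allowed) with an object of $\mathcal C$ at each vertex and a morphism along each edge; no commutativity is required. A \emph{mixed computation} is a finite sequence $(D_0,\dots,D_s)$ of diagrams such that $D_0$ is a finite diagram consisting of morphisms in $\mathcal A$ (every edge carries a morphism in $\mathcal A$, and every vertex is an endpoint of an edge), and each $D_i$ with $i\ge 1$ is obtained from $D_{i-1}$ by choosing a full subdiagram of $D_{i-1}$ and adding either a limit of it, as a new vertex together with the limit cone morphisms out of it, or a colimit of it, as a new vertex together with the colimit cocone morphisms into it. Its \emph{cost} is $s$ plus the number of edges of $D_0$. The \emph{mixed complexity} of an object $X$ is the least cost of a mixed computation whose last diagram contains a vertex whose object is isomorphic to $X$ (and $\infty$ if there is none). For a field $k$, let $\mathcal C=\mathrm{Sch}_k$ be the category of schemes over $k$, and let $\mathcal A$ consist of the following morphisms over $k$: multiplication by $c$, $\mathbb A^1\to\mathbb A^1$, for each $c\in k$; addition, multiplication and the two projections $\mathbb A^1\times\mathbb A^1\to\mathbb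 A^1$; the morphism $\mathbb A^1\to\mathbb A^0$; and the point $c:\mathbb A^0\to\mathbb A^1$ for each $c\in k$. An \emph{arithmetic circuit} over $k$ in given variables is a finite directed acyclic graph (without parallel edges) in which each vertex of indegree $0$ is labelled by a variable or an element of $k$, and each other vertex (of arbitrary positive indegree) is labelled by $+$ or $\times$. Its \emph{size} is its number of vertices. Each vertex computes a polynomial: its label if it has indegree $0$, and otherwise the sum or the product of the polynomials computed at its predecessors. The circuit \emph{computes} $f$ if $f$ is the polynomial of some vertex. \textbf{Proposition (mixed complexity of projective schemes).} There is an absolute constant $K$ such that the following holds for every field $k$ and all integers $n\ge 1$, $m\ge 1$. Let $f_1,\dots,f_m\in k[x_0,\dots,x_n]$ be homogeneous polynomials and let $X=\operatorname{Proj}\bigl(k[x_0,\dots,x_n]/(f_1,\dots,f_m)\bigr)\subset\mathbb P^n_k$ be their zero scheme. Assume that, for each $i$, there is an arithmetic circuit of size $c_i$ computing $f_i$. Then the mixed complexity of $X$ in $\mathrm{Sch}_k$ with respect to $\mathcal A$ is at most $$K\,n^2\,(c_1+\dots+c_m).$$ -/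

import Mathlib

open CategoryTheory AlgebraicGeometry

universe u v w

noncomputable section

/-! ## Diagrams and mixed computations in a category -/

/-- A diagram in `C`: a directed graph (parallel edges and loops allowed), with an object on each
vertex and a morphism on each edge. No commutativity is required. -/
structure GraphDiagram (C : Type u) [Category.{v} C] where
  V : Type
  E : V → V → Type
  obj : V → C
  map : ∀ {a b : V}, E a b → (obj a ⟶ obj b)

namespace GraphDiagram

variable {C : Type u} [Category.{v} C]

/-- The diagram with the single vertex `X` and no edges. -/
def single (X : C) : GraphDiagram C where
  V := Unit
  E := fun _ _ => Empty
  obj := fun _ => X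
  map := fun e => e.elim

/-- `π` is a cone with vertex `L` over the full subdiagram of `D` on the set `W` of vertices. -/
def IsCone (D : GraphDiagram C) (W : Set D.V) (L : C) (π : ∀ a : W, L ⟶ D.obj a) : Prop :=
  ∀ (a b : W) (e : D.E a b), π a ≫ D.map e = π b

/-- `π` is a limit cone over the full subdiagram of `D` on `W`. -/
def IsLimitCone (D : GraphDiagram C) (W : Set D.V) (L : C) (π : ∀ a : W, L ⟶ D.obj a) : Prop :=
  D.IsCone W L π ∧
    ∀ (M : C) (φ : ∀ a : W, M ⟶ D.obj a), D.IsCone W M φ → ∃! h : M ⟶ L, ∀ a, h ≫ π a = φ a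

/-- `ι` is a cocone with vertex `L` over the full subdiagram of `D` on the set `W` of vertices. -/
def IsCocone (D : GraphDiagram C) (W : Set D.V) (L : C) (ι : ∀ a : W, D.obj a ⟶ L) : Prop :=
  ∀ (a b : W) (e : D.E a b), D.map e ≫ ι b = ι a

/-- `ι` is a colimit cocone over the full subdiagram of `D` on `W`. -/
def IsColimitCocone (D : GraphDiagram C) (W : Set D.V) (L : C) (ι : ∀ a : W, D.obj a ⟶ L) :
    Prop :=
  D.IsCocone W L ι ∧
    ∀ (M : C) (φ : ∀ a : W, D.obj a ⟶ M), D.IsCocone W M φ → ∃! h : L ⟶ M, ∀ a, ι a ≫ h = φ a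

/-- The vertices of `D` with their objects, and a new vertex `none` carrying `L`. -/
def newObj (D : GraphDiagram C) (L : C) : Option D.V → C
  | some a => D.obj a
  | none => L

/-- The edges of `D`, and one edge from the new vertex to each vertex of `W`. -/
def coneEdge (D : GraphDiagram C) (W : Set D.V) : Option D.V → Option D.V → Type
  | some a, some b => D.E a b
  | none, some a => PLift (a ∈ W)
  | _, none => Empty

/-- The edges of `D`, and one edge from each vertex of `W` to the new vertex. -/
def coconeEdge (D : GraphDiagram C) (W : Set D.V) : Option D.V → Option D.V → Type
  | some a, some b => D.E a b
  | some a, none => PLift (a ∈ W)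
  | none, _ => Empty

/-- The diagram `D` with a new vertex `L` and the morphisms `π` out of it added. -/
def addCone (D : GraphDiagram C) (W : Set D.V) (L : C) (π : ∀ a : W, L ⟶ D.obj a) :
    GraphDiagram C where
  V := Option D.V
  E := D.coneEdge W
  obj := D.newObj L
  map := fun {a b} => match a, b with
    | some _, some _ => fun e => D.map e
    | none, some a => fun e => π ⟨a, e.down⟩
    | some _, none => fun e => Empty.elim e
    | none, none => fun e => Empty.elim e

/-- The diagram `D` with a new vertex `L` and the morphisms `ι` into it added. -/
def addCocone (D : GraphDiagram C) (W : Set D.V) (L : C) (ι : ∀ a : W, D.obj a ⟶ L) :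
    GraphDiagram C where
  V := Option D.V
  E := D.coconeEdge W
  obj := D.newObj L
  map := fun {a b} => match a, b with
    | some _, some _ => fun e => D.map e
    | some a, none => fun e => ι ⟨a, e.down⟩
    | none, some _ => fun e => Empty.elim e
    | none, none => fun e => Empty.elim e

/-- `D` is a finite diagram consisting of morphisms in `A`: each edge carries a morphism in `A`, and
each vertex is the source or the target of an edge. -/
structure IsInitial (A : MorphismProperty C) (D : GraphDiagram C) : Prop where
  finite_vertices : Finite D.V
  finite_edges : ∀ a b, Finite (D.E a b)
  mem : ∀ (a b : D.V) (e : D.E a b), A (D.map e)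
  covered : ∀ a : D.V, ∃ b : D.V, Nonempty (D.E a b) ∨ Nonempty (D.E b a)

/-- `MixedComputation A D c`: there is a mixed computation `(D₀, …, D_s)` with basic morphisms `A`,
each of unit cost, with last diagram `D_s = D` and with cost `c`, the number of edges of `D₀`
plus `s`. Each step adds a limit cone or a colimit cocone of a full subdiagram. -/
inductive MixedComputation (A : MorphismProperty C) : GraphDiagram C → ℕ → Prop
  | init (D : GraphDiagram C) (hD : D.IsInitial A) :
      MixedComputation A D (Nat.card (Σ a b : D.V, D.E a b))
  | lim {D : GraphDiagram C} {c : ℕ} (h : MixedComputation A D c) (W : Set D.V) (L : C)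
      (π : ∀ a : W, L ⟶ D.obj a) (hπ : D.IsLimitCone W L π) :
      MixedComputation A (D.addCone W L π) (c + 1)
  | colim {D : GraphDiagram C} {c : ℕ} (h : MixedComputation A D c) (W : Set D.V) (L : C)
      (ι : ∀ a : W, D.obj a ⟶ L) (hι : D.IsColimitCocone W L ι) :
      MixedComputation A (D.addCocone W L ι) (c + 1)

/-- `D` is isomorphic to a (not necessarily full) subdiagram of `D'`. -/
def IsSubdiagram (D D' : GraphDiagram C) : Prop :=
  ∃ (φ : D.V → D'.V) (ψ : ∀ {a b : D.V}, D.E a b → D'.E (φ a) (φ b))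
    (θ : ∀ a, D.obj a ≅ D'.obj (φ a)),
    Function.Injective φ ∧ (∀ a b, Function.Injective (ψ (a := a) (b := b))) ∧
      ∀ (a b : D.V) (e : D.E a b), D.map e ≫ (θ b).hom = (θ a).hom ≫ D'.map (ψ e)

/-- The mixed complexity of a diagram `D` with respect to the set `A` of basic morphisms: the least
cost of a mixed computation that computes `D`, and `⊤` if there is none. -/
def mixedComplexity (A : MorphismProperty C) (D : GraphDiagram C) : ℕ∞ :=
  ⨅ (D' : GraphDiagram C) (c : ℕ) (_ : MixedComputation A D' c) (_ : D.IsSubdiagram D'), (c : ℕ∞)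

end GraphDiagram

/-- The mixed complexity of an object: that of the diagram with this object and no edges. -/
def mixedComplexity {C : Type u} [Category.{v} C] (A : MorphismProperty C) (X : C) : ℕ∞ :=
  (GraphDiagram.single X).mixedComplexity A

/-! ## Arithmetic circuits -/

/-- The label of a vertex of an arithmetic circuit. -/
inductive CircuitLabel (k : Type u) (σ : Type w)
  | var (i : σ)
  | const (c : k)
  | add
  | mul

/-- A label of an input vertex: a variable or a constant. -/
def CircuitLabel.IsLeaf {k : Type u} {σ : Type w} : CircuitLabel k σ → Prop
  | var _ => True
  | const _ => True
  | add => False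
  | mul => False

/-- An arithmetic circuit over `k` in the variables `σ`: a finite directed acyclic graph whose
vertices of indegree `0`, and only these, are labelled by variables or constants, and whose other
vertices are labelled by `+` or `×`. Any positive indegree is allowed. -/
structure ArithmeticCircuit (k : Type u) (σ : Type w) where
  V : Type
  fintypeV : Fintype V
  /-- `E a b`: there is an edge from `a` to `b`. -/
  E : V → V → Prop
  acyclic : ∀ a, ¬ Relation.TransGen E a a
  label : V → CircuitLabel k σ
  isLeaf_iff : ∀ b, (label b).IsLeaf ↔ ∀ a, ¬ E a b

namespace ArithmeticCircuit

attribute [instance] ArithmeticCircuit.fintypeV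

variable {k : Type u} [CommSemiring k] {σ : Type w}

/-- The size of a circuit is its number of vertices. -/
def size (Γ : ArithmeticCircuit k σ) : ℕ := Fintype.card Γ.V

open Classical in
/-- The value that a vertex must have, given the values `p` of its predecessors. -/
def gateValue (Γ : ArithmeticCircuit k σ) (p : Γ.V → MvPolynomial σ k) (b : Γ.V) :
    MvPolynomial σ k :=
  match Γ.label b with
  | .var i => MvPolynomial.X i
  | .const c => MvPolynomial.C c
  | .add => ∑ a ∈ Finset.univ.filter (fun a => Γ.E a b), p a
  | .mul => ∏ a ∈ Finset.univ.filter (fun a => Γ.E a b), p a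

/-- `f` is the polynomial associated to some vertex of `Γ`. Since `Γ` is acyclic, there is exactly
one assignment `p` of polynomials to the vertices that is compatible with all labels. -/
def Computes (Γ : ArithmeticCircuit k σ) (f : MvPolynomial σ k) : Prop :=
  ∃ p : Γ.V → MvPolynomial σ k, (∀ b, p b = Γ.gateValue p b) ∧ ∃ b, p b = f

end ArithmeticCircuit

/-! ## Schemes over a field and the basic morphisms -/

/-- The category of schemes over `k`. -/
abbrev SchemeOver (k : Type u) [Field k] : Type (u + 1) := Over (Spec (CommRingCat.of k))

section Affine

variable (k : Type u) [Field k]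

/-- The affine space of dimension `d` over `k`, as the spectrum of the polynomial ring. -/
def affSpace (d : ℕ) : SchemeOver k :=
  Over.mk (Spec.map (CommRingCat.ofHom (algebraMap k (MvPolynomial (Fin d) k))))

/-- The morphism of affine spaces over `k` with the components `p₁, …, p_e`. -/
def affMap {d e : ℕ} (p : Fin e → MvPolynomial (Fin d) k) : affSpace k d ⟶ affSpace k e :=
  Over.homMk
    (Spec.map (CommRingCat.ofHom
      (MvPolynomial.aeval p : MvPolynomial (Fin e) k →ₐ[k] MvPolynomial (Fin d) k).toRingHom))
    (by
      change Spec.map _ ≫ Spec.map _ = Spec.map _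
      rw [← Spec.map_comp, ← CommRingCat.ofHom_comp]
      congr 2
      exact AlgHom.comp_algebraMap
        (MvPolynomial.aeval p : MvPolynomial (Fin e) k →ₐ[k] MvPolynomial (Fin d) k))

open MvPolynomial in
/-- The basic morphisms: on the affine line `𝔸¹`, multiplication by a constant; from the plane
`𝔸² = 𝔸¹ × 𝔸¹` to `𝔸¹`, addition, multiplication and the two projections; the morphism from `𝔸¹` to
the point `𝔸⁰`; and the `k`-rational points of `𝔸¹`. -/
inductive BasicMorphism : MorphismProperty (SchemeOver k)
  | scale (c : k) : BasicMorphism (affMap k (d := 1) (e := 1) ![C c * X 0])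
  | add : BasicMorphism (affMap k (d := 2) (e := 1) ![X 0 + X 1])
  | mul : BasicMorphism (affMap k (d := 2) (e := 1) ![X 0 * X 1])
  | fst : BasicMorphism (affMap k (d := 2) (e := 1) ![X 0])
  | snd : BasicMorphism (affMap k (d := 2) (e := 1) ![X 1])
  | toPoint : BasicMorphism (affMap k (d := 1) (e := 0) ![])
  | point (c : k) : BasicMorphism (affMap k (d := 0) (e := 1) ![C c])

end Affine

/-! ## Quotients of graded algebras -/

section QuotientGrading

variable {k : Type u} [Field k] {S : Type u} [CommRing S] [Algebra k S]
  {𝒜 : ℕ → Submodule k S} [GradedAlgebra 𝒜] (I : HomogeneousIdeal 𝒜)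

/-- The degree `i` part of `S ⧸ I` is the image of the degree `i` part of `S`. -/
def quotientGrading (i : ℕ) : Submodule k (S ⧸ I.toIdeal) :=
  (𝒜 i).map (Ideal.Quotient.mkₐ k I.toIdeal).toLinearMap

/-- The quotient map on parts of degree `i`. -/
def quotientGradingMap (i : ℕ) : 𝒜 i →ₗ[k] quotientGrading I i :=
  (Ideal.Quotient.mkₐ k I.toIdeal).toLinearMap.restrict
    (fun _ hx => Submodule.mem_map_of_mem hx)

instance quotientGrading_gradedMonoid : SetLike.GradedMonoid (quotientGrading I) where
  one_mem := ⟨1, SetLike.GradedOne.one_mem, map_one (Ideal.Quotient.mk I.toIdeal)⟩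
  mul_mem := by
    rintro i j _ _ ⟨x, hx, rfl⟩ ⟨y, hy, rfl⟩
    exact ⟨x * y, SetLike.GradedMul.mul_mem hx hy, map_mul (Ideal.Quotient.mk I.toIdeal) _ _⟩

/-- The decomposition of `S ⧸ I` into its homogeneous parts, on elements. -/
def quotientDecompose : (S ⧸ I.toIdeal) →+ DirectSum ℕ (fun i => quotientGrading I i) :=
  QuotientAddGroup.lift I.toIdeal.toAddSubgroup
    ((DirectSum.lmap (quotientGradingMap I)).toAddMonoidHom.comp
      (DirectSum.decomposeAddEquiv 𝒜).toAddMonoidHom) (by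
    intro x hx
    refine DFinsupp.ext fun i => Subtype.ext ?_
    exact (Ideal.Quotient.eq_zero_iff_mem).2 (I.isHomogeneous i hx))

lemma quotientDecompose_mk_of_mem {i : ℕ} (x : 𝒜 i) :
    quotientDecompose I (Ideal.Quotient.mk I.toIdeal x) =
      DirectSum.of (fun i => quotientGrading I i) i (quotientGradingMap I i x) := by
  change DirectSum.lmap (quotientGradingMap I) (DirectSum.decompose 𝒜 (x : S)) = _
  rw [DirectSum.decompose_coe]
  exact DirectSum.lmap_of _ _ _

instance quotientGrading_gradedAlgebra : GradedAlgebra (quotientGrading I) where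
  toDecomposition := DirectSum.Decomposition.ofAddHom _ (quotientDecompose I)
    (by
      refine AddMonoidHom.ext fun y => ?_
      obtain ⟨x, rfl⟩ := Ideal.Quotient.mk_surjective y
      induction x using DirectSum.Decomposition.inductionOn 𝒜 with
      | zero => simp
      | homogeneous x =>
        rw [AddMonoidHom.comp_apply, quotientDecompose_mk_of_mem]
        exact DirectSum.coeAddMonoidHom_of _ _ _
      | add x y hx hy => rw [map_add, map_add, hx, hy, map_add])
    (by
      refine DirectSum.addHom_ext fun i y => ?_
      obtain ⟨_, x, hx, rfl⟩ := y
      rw [AddMonoidHom.comp_apply, DirectSum.coeAddMonoidHom_of]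
      exact quotientDecompose_mk_of_mem I ⟨x, hx⟩)

/-- The quotient map `S → S ⧸ I` as a homomorphism of graded rings. -/
def quotientGradedHom : GradedRingHom 𝒜 (quotientGrading I) where
  toRingHom := Ideal.Quotient.mk I.toIdeal
  map_mem := fun hx => Submodule.mem_map_of_mem hx

lemma irrelevant_le_map_quotientGradedHom :
    HomogeneousIdeal.irrelevant (quotientGrading I) ≤
      (HomogeneousIdeal.irrelevant 𝒜).map (quotientGradedHom I) := by
  rw [HomogeneousIdeal.irrelevant_le]
  rintro i hi _ ⟨x, hx, rfl⟩
  exact Ideal.mem_map_of_mem (quotientGradedHom I)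
    (HomogeneousIdeal.mem_irrelevant_of_mem 𝒜 hi hx)

end QuotientGrading

/-! ## Projective space and zero schemes -/

attribute [local instance] MvPolynomial.gradedAlgebra

section Projective

variable (k : Type u) [Field k] (n : ℕ)

/-- The grading of `k[x₀, …, x_n]` by the degree. -/
abbrev projGrading : ℕ → Submodule k (MvPolynomial (Fin (n + 1)) k) :=
  MvPolynomial.homogeneousSubmodule (Fin (n + 1)) k

/-- The projective space of dimension `n` over `k`. -/
def projSpace : SchemeOver k :=
  Over.mk (Proj.toSpecZero (projGrading k n) ≫
    Spec.map (CommRingCat.ofHom (algebraMap k (projGrading k n 0))))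

variable {k n} {m : ℕ} (f : Fin m → MvPolynomial (Fin (n + 1)) k)
  (hf : ∀ i, ∃ d, (f i).IsHomogeneous d)

/-- The homogeneous ideal generated by homogeneous polynomials `f₁, …, f_m`. -/
def zeroIdeal : HomogeneousIdeal (projGrading k n) where
  carrier := Ideal.span (Set.range f)
  add_mem' := fun ha hb => add_mem ha hb
  zero_mem' := zero_mem _
  smul_mem' := fun c _ hx => Ideal.mul_mem_left _ c hx
  is_homogeneous' := Ideal.homogeneous_span (projGrading k n) _ (by
    rintro _ ⟨i, rfl⟩
    exact hf i)

/-- The inclusion into projective space of the closed subscheme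
`Proj (k[x₀, …, x_n] / (f₁, …, f_m))`. -/
def zeroSchemeInclusion :
    Proj (quotientGrading (zeroIdeal f hf)) ⟶ Proj (projGrading k n) :=
  Proj.map (quotientGradedHom (zeroIdeal f hf)) (irrelevant_le_map_quotientGradedHom _)

/-- The zero scheme in projective space of homogeneous polynomials `f₁, …, f_m`, as a scheme
over `k`. -/
def zeroScheme : SchemeOver k :=
  Over.mk (zeroSchemeInclusion f hf ≫ (projSpace k n).hom)

end Projective

end

noncomputable section

/-! A limit of schemes over `k` is a solution scheme: its points over `M` are families of functions
on `M` satisfying the constraints in the chosen full subdiagram, while a variable that is left out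
of the subdiagram becomes internal to the constraint that mentions it. Hence each scheme needed to
build `X` can be adjoined at unit cost as a limit over one common initial diagram of O(n + N) basic
morphisms, N being the sum of the circuit sizes.

The difficulty is unbounded fan-in: circuits of total size N may have of the order of N² edges. The
initial diagram therefore contains only one chain of N additions and one of N multiplications, with
common inputs `w a`. For each `a` it also has constraints that load `y a` into `w a`, or set `w a`
to 0 or to 1. The gate at `b` is the limit of the full subdiagram that loads the predecessors of `b`
and puts the neutral element elsewhere, so selecting predecessors costs nothing. Later limits
contain the gates and the `y a` but not the inputs and partial results of the chains, so the same
chains serve all gates (`GateSystem.sat_gate_iff`).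

Circuits are acyclic, so the gate equations force every `y b` to be the polynomial computed at `b`
(`GateSystem.holds_iff`). The i-th standard chart, where `z i = 1` and all `f j` vanish, is then a
single limit (`exists_chartLimit`). The overlap of charts i and j consists of a point of each
together with a scalar that carries the coordinates of the first to those of the second
(`exists_overlapLimit`). The two points need independent coordinates, so every chart is built twice,
with its coordinates copied to `x false` or to `x true`. A single colimit of charts and overlaps
gives `X` (`ProjectiveAtlas.mixedComplexity_le`); `zeroAtlas` supplies the algebra, namely the
universal properties of the degree 0 localizations and the gluing of Proj. The cost is O(n + N) for
edges and gates (there are m ≤ N equations), 2(n+1) for charts, (n+1)² for overlaps, and 1 for the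
colimit. -/

/-! ## Diagrams with sets of morphisms, and their embeddings into computed diagrams -/

/-- A diagram given by objects on a type of vertices and, for any two vertices, a set of
morphisms between their objects. -/
structure RelDiagram (C : Type u) [Category.{v} C] where
  V : Type
  obj : V → C
  rel : ∀ a b : V, (obj a ⟶ obj b) → Prop

namespace RelDiagram

variable {C : Type u} [Category.{v} C]

/-- `π` is a cone with vertex `L` over the full subdiagram of `D` on `W`. -/
def IsCone (D : RelDiagram C) (W : Set D.V) (L : C) (π : ∀ a : W, L ⟶ D.obj a) : Prop :=
  ∀ (a b : W) (e : D.obj a ⟶ D.obj b), D.rel a b e → π a ≫ e = π b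

/-- `π` is a limit cone over the full subdiagram of `D` on `W`. -/
def IsLimitCone (D : RelDiagram C) (W : Set D.V) (L : C) (π : ∀ a : W, L ⟶ D.obj a) : Prop :=
  D.IsCone W L π ∧
    ∀ (M : C) (φ : ∀ a : W, M ⟶ D.obj a), D.IsCone W M φ → ∃! h : M ⟶ L, ∀ a, h ≫ π a = φ a

/-- `ι` is a cocone with vertex `L` over the full subdiagram of `D` on `W`. -/
def IsCocone (D : RelDiagram C) (W : Set D.V) (L : C) (ι : ∀ a : W, D.obj a ⟶ L) : Prop :=
  ∀ (a b : W) (e : D.obj a ⟶ D.obj b), D.rel a b e → e ≫ ι b = ι a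

/-- `ι` is a colimit cocone over the full subdiagram of `D` on `W`. -/
def IsColimitCocone (D : RelDiagram C) (W : Set D.V) (L : C) (ι : ∀ a : W, D.obj a ⟶ L) : Prop :=
  D.IsCocone W L ι ∧
    ∀ (M : C) (φ : ∀ a : W, D.obj a ⟶ M), D.IsCocone W M φ → ∃! h : L ⟶ M, ∀ a, ι a ≫ h = φ a

/-- An identification of `D` with a full subdiagram of the graph diagram `D'`. -/
structure Embedding (D : RelDiagram C) (D' : GraphDiagram C) where
  φ : D.V → D'.V
  inj : Function.Injective φ
  θ : ∀ a, D.obj a ≅ D'.obj (φ a)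
  rel_iff : ∀ (a b : D.V) (g : D.obj a ⟶ D.obj b),
    D.rel a b g ↔ ∃ e : D'.E (φ a) (φ b), D'.map e = (θ a).inv ≫ g ≫ (θ b).hom

/-- Restriction of an embedding to a full subdiagram. -/
def Embedding.comap {D₁ D₂ : RelDiagram C} {D' : GraphDiagram C} (F : Embedding D₂ D')
    (j : D₁.V → D₂.V) (hj : Function.Injective j) (η : ∀ a, D₁.obj a ≅ D₂.obj (j a))
    (hrel : ∀ (a b : D₁.V) (g : D₁.obj a ⟶ D₁.obj b),
      D₁.rel a b g ↔ D₂.rel (j a) (j b) ((η a).inv ≫ g ≫ (η b).hom)) : Embedding D₁ D' where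
  φ := F.φ ∘ j
  inj := F.inj.comp hj
  θ a := η a ≪≫ F.θ (j a)
  rel_iff a b g := by
    rw [hrel, F.rel_iff]
    simp

lemma Embedding.map_rel {D : RelDiagram C} {D' : GraphDiagram C} (F : Embedding D D') {a b : D.V}
    (e : D'.E (F.φ a) (F.φ b)) : D.rel a b ((F.θ a).hom ≫ D'.map e ≫ (F.θ b).inv) :=
  (F.rel_iff _ _ _).2 ⟨e, by simp⟩

/-- Being a limit depends only on which morphisms occur between the chosen vertices, and `rel_iff`
matches these up to the isomorphisms `θ`. The formula for the legs is kept because the embedding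
must later be extended to the new vertex. -/
lemma Embedding.isLimitCone {D : RelDiagram C} {D' : GraphDiagram C} (F : Embedding D D')
    {W : Set D.V} {L : C} {π : ∀ a : W, L ⟶ D.obj a} (h : D.IsLimitCone W L π) :
    ∃ π' : ∀ a : (F.φ '' W : Set D'.V), L ⟶ D'.obj a, D'.IsLimitCone (F.φ '' W) L π' ∧
      ∀ a : W, π' ⟨F.φ a, Set.mem_image_of_mem _ a.2⟩ = π a ≫ (F.θ a).hom := by
  -- A vertex of the image equals some `F.φ a` only propositionally, so its leg is pinned down up to
  -- `eqToHom`; injectivity of `F.φ` makes this consistent.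
  have key : ∀ a' : (F.φ '' W : Set D'.V), ∃ g : L ⟶ D'.obj a', ∀ (a : W) (e : F.φ a = a'),
      g = π a ≫ (F.θ a).hom ≫ eqToHom (by rw [e]) := by
    rintro ⟨_, a, ha, rfl⟩
    refine ⟨π ⟨a, ha⟩ ≫ (F.θ a).hom, fun b e => ?_⟩
    obtain ⟨b, hb⟩ := b
    obtain rfl := F.inj e
    simp
  choose π' hπ' using key
  have hπ : ∀ a : W, π' ⟨F.φ a, Set.mem_image_of_mem _ a.2⟩ = π a ≫ (F.θ a).hom := fun a => by
    simpa using hπ' ⟨F.φ a, Set.mem_image_of_mem _ a.2⟩ a rfl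
  refine ⟨π', ⟨?_, ?_⟩, hπ⟩
  · rintro ⟨_, a, ha, rfl⟩ ⟨_, b, hb, rfl⟩ e
    have h1 := h.1 ⟨a, ha⟩ ⟨b, hb⟩ _ (F.map_rel e)
    have h2 := hπ ⟨a, ha⟩
    have h3 := hπ ⟨b, hb⟩
    dsimp only at h2 h3 ⊢
    rw [h2, h3, ← h1]
    simp
  · intro M ψ hψ
    obtain ⟨g, hg, hu⟩ := h.2 M
      (fun a => ψ ⟨F.φ a, Set.mem_image_of_mem _ a.2⟩ ≫ (F.θ a).inv) (by
        intro a b e he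
        obtain ⟨e', he'⟩ := (F.rel_iff _ _ _).1 he
        have h1 := hψ ⟨F.φ a, Set.mem_image_of_mem _ a.2⟩ ⟨F.φ b, Set.mem_image_of_mem _ b.2⟩ e'
        dsimp only
        rw [← h1, he']
        simp)
    refine ⟨g, ?_, fun g' hg' => hu g' fun a => ?_⟩
    · rintro ⟨_, a, ha, rfl⟩
      have h1 := hg ⟨a, ha⟩
      have h2 := hπ ⟨a, ha⟩
      dsimp only at h1 h2 ⊢
      rw [h2, ← Category.assoc, h1]
      simp
    · dsimp only
      rw [← hg', hπ]
      simp

/-- The legs need not be tracked here, since a colimit is taken only in the last step. -/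
lemma Embedding.isColimitCocone {D : RelDiagram C} {D' : GraphDiagram C} (F : Embedding D D')
    {W : Set D.V} {L : C} {ι : ∀ a : W, D.obj a ⟶ L} (h : D.IsColimitCocone W L ι) :
    ∃ ι' : ∀ a : (F.φ '' W : Set D'.V), D'.obj a ⟶ L, D'.IsColimitCocone (F.φ '' W) L ι' := by
  have key : ∀ a' : (F.φ '' W : Set D'.V), ∃ g : D'.obj a' ⟶ L, ∀ (a : W) (e : F.φ a = a'),
      g = eqToHom (by rw [e]) ≫ (F.θ a).inv ≫ ι a := by
    rintro ⟨_, a, ha, rfl⟩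
    refine ⟨(F.θ a).inv ≫ ι ⟨a, ha⟩, fun b e => ?_⟩
    obtain ⟨b, hb⟩ := b
    obtain rfl := F.inj e
    simp
  choose ι' hι' using key
  have hι : ∀ a : W, ι' ⟨F.φ a, Set.mem_image_of_mem _ a.2⟩ = (F.θ a).inv ≫ ι a := fun a => by
    simpa using hι' ⟨F.φ a, Set.mem_image_of_mem _ a.2⟩ a rfl
  refine ⟨ι', ?_, ?_⟩
  · rintro ⟨_, a, ha, rfl⟩ ⟨_, b, hb, rfl⟩ e
    have h1 := h.1 ⟨a, ha⟩ ⟨b, hb⟩ _ (F.map_rel e)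
    have h2 := hι ⟨a, ha⟩
    have h3 := hι ⟨b, hb⟩
    dsimp only at h2 h3 ⊢
    rw [h2, h3, ← h1]
    simp
  · intro M ψ hψ
    obtain ⟨g, hg, hu⟩ := h.2 M
      (fun a => (F.θ a).hom ≫ ψ ⟨F.φ a, Set.mem_image_of_mem _ a.2⟩) (by
        intro a b e he
        obtain ⟨e', he'⟩ := (F.rel_iff _ _ _).1 he
        have h1 := hψ ⟨F.φ a, Set.mem_image_of_mem _ a.2⟩ ⟨F.φ b, Set.mem_image_of_mem _ b.2⟩ e'
        dsimp only
        rw [← h1, he']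
        simp)
    refine ⟨g, ?_, fun g' hg' => hu g' fun a => ?_⟩
    · rintro ⟨_, a, ha, rfl⟩
      have h1 := hg ⟨a, ha⟩
      have h2 := hι ⟨a, ha⟩
      dsimp only at h1 h2 ⊢
      rw [h2, Category.assoc, h1]
      simp
    · rw [← hg', hι]
      simp

/-- `D` is a full subdiagram of the last diagram of a mixed computation of cost `c`. -/
def Computes (A : MorphismProperty C) (D : RelDiagram C) (c : ℕ) : Prop :=
  ∃ D' : GraphDiagram C, D'.MixedComputation A c ∧ Nonempty (Embedding D D')

/-- The diagram `D` with a family of new vertices `L t` and the morphisms `π t` out of them. -/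
def extend (D : RelDiagram C) {T : Type} (W : T → Set D.V) (L : T → C)
    (π : ∀ (t : T) (a : W t), L t ⟶ D.obj a) : RelDiagram C where
  V := D.V ⊕ T
  obj := Sum.elim D.obj L
  rel
    | .inl a, .inl b => D.rel a b
    | .inr t, .inl a => fun g => ∃ h : a ∈ W t, g = π t ⟨a, h⟩
    | _, .inr _ => fun _ => False

/-- An embedding of an extension of `D`, restricted to `D`. -/
def Embedding.ofExtend {D : RelDiagram C} {D' : GraphDiagram C} {T : Type} {W : T → Set D.V}
    {L : T → C} {π : ∀ (t : T) (a : W t), L t ⟶ D.obj a} (F : Embedding (D.extend W L π) D') :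
    Embedding D D' where
  φ a := F.φ (.inl a)
  inj := F.inj.comp Sum.inl_injective
  θ a := F.θ (.inl a)
  rel_iff a b g := F.rel_iff (.inl a) (.inl b) g

/-- The embedding of an extension by one more vertex. -/
def Embedding.option {D : RelDiagram C} {D' : GraphDiagram C} {T : Type}
    {W : Option T → Set D.V} {L : Option T → C} {π : ∀ (t : Option T) (a : W t), L t ⟶ D.obj a}
    (F : Embedding (D.extend (fun t => W (some t)) (fun t => L (some t)) (fun t => π (some t))) D')
    (π' : ∀ a : ((fun a => F.φ (.inl a)) '' W none : Set D'.V), L none ⟶ D'.obj a)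
    (hπ' : ∀ a : W none, π' ⟨F.φ (.inl a), ⟨a, a.2, rfl⟩⟩ = π none a ≫ (F.θ (.inl a)).hom) :
    Embedding (D.extend W L π) (D'.addCone _ (L none) π') where
  φ
    | .inl a => some (F.φ (.inl a))
    | .inr (some t) => some (F.φ (.inr t))
    | .inr none => none
  inj := by
    rintro (a | _ | a) (b | _ | b) h
    · exact congrArg _ (Sum.inl_injective (F.inj (Option.some.inj h)))
    · exact absurd h (Option.some_ne_none _)
    · exact (Sum.inl_ne_inr (F.inj (Option.some.inj h))).elim
    · exact absurd h.symm (Option.some_ne_none _)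
    · rfl
    · exact absurd h.symm (Option.some_ne_none _)
    · exact (Sum.inr_ne_inl (F.inj (Option.some.inj h))).elim
    · exact absurd h (Option.some_ne_none _)
    · exact congrArg _ (congrArg _ (Sum.inr_injective (F.inj (Option.some.inj h))))
  θ
    | .inl a => F.θ (.inl a)
    | .inr (some t) => F.θ (.inr t)
    | .inr none => Iso.refl _
  rel_iff := by
    rintro (a | _ | a) (b | _ | b) g
    · exact F.rel_iff (.inl a) (.inl b) g
    · exact ⟨fun h => h.elim, fun ⟨e, _⟩ => Empty.elim e⟩
    · exact F.rel_iff (.inl a) (.inr b) g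
    · constructor
      · rintro ⟨h, rfl⟩
        refine ⟨⟨b, h, rfl⟩, ?_⟩
        exact (hπ' ⟨b, h⟩).trans (Category.id_comp _).symm
      · rintro ⟨⟨b', h, e⟩, he⟩
        obtain rfl := Sum.inl_injective (F.inj e)
        refine ⟨h, ?_⟩
        have h1 := ((hπ' ⟨b', h⟩).symm.trans he).trans (Category.id_comp _)
        exact ((cancel_mono (F.θ (.inl b')).hom).1 h1).symm
    · exact ⟨fun h => h.elim, fun ⟨e, _⟩ => Empty.elim e⟩
    · exact ⟨fun h => h.elim, fun ⟨e, _⟩ => by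
        obtain ⟨_, _, h⟩ := e
        simpa using F.inj h⟩
    · exact F.rel_iff (.inr a) (.inl b) g
    · exact ⟨fun h => h.elim, fun ⟨e, _⟩ => Empty.elim e⟩
    · exact F.rel_iff (.inr a) (.inr b) g

/-- Limits of full subdiagrams can be adjoined at unit cost each. -/
theorem Computes.extend {A : MorphismProperty C} {D : RelDiagram C} {c : ℕ} (hD : D.Computes A c)
    {T : Type} [Finite T] (W : T → Set D.V) (L : T → C) (π : ∀ (t : T) (a : W t), L t ⟶ D.obj a)
    (h : ∀ t, D.IsLimitCone (W t) (L t) (π t)) : (D.extend W L π).Computes A (c + Nat.card T) := by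
  refine Finite.induction_empty_option (P := fun T => ∀ (W : T → Set D.V) (L : T → C)
    (π : ∀ (t : T) (a : W t), L t ⟶ D.obj a), (∀ t, D.IsLimitCone (W t) (L t) (π t)) →
      (D.extend W L π).Computes A (c + Nat.card T)) ?_ ?_ ?_ T W L π h
  · intro T₁ T₂ e ih W L π h
    obtain ⟨D', hD', ⟨F⟩⟩ := ih (fun t => W (e t)) (fun t => L (e t)) (fun t => π (e t))
      (fun t => h (e t))
    refine ⟨D', Nat.card_congr e ▸ hD', ⟨F.comap (Sum.map id e.symm)
      (Sum.map_injective.2 ⟨Function.injective_id, e.symm.injective⟩)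
      (fun a => match a with
        | .inl a => Iso.refl _
        | .inr t => eqToIso (by simp [RelDiagram.extend])) ?_⟩⟩
    rintro (a | t) (b | s) g
    · change D.obj a ⟶ D.obj b at g
      change D.rel a b g ↔ D.rel a b (𝟙 (D.obj a) ≫ g ≫ 𝟙 (D.obj b))
      rw [Category.comp_id, Category.id_comp]
    · exact Iff.rfl
    · change L t ⟶ D.obj b at g
      -- Transport along `e (e.symm t) = t`, stated for a general equality so that it can be
      -- eliminated.
      have key : ∀ (t' : T₂) (h' : t' = t), (∃ hb : b ∈ W t, g = π t ⟨b, hb⟩) ↔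
          ∃ hb : b ∈ W t', eqToHom (by rw [h']) ≫ g = π t' ⟨b, hb⟩ := by
        rintro _ rfl
        simp
      refine (key (e (e.symm t)) (by simp)).trans ?_
      change _ ↔ ∃ hb : b ∈ W (e (e.symm t)),
        eqToHom (congrArg L (e.apply_symm_apply t)) ≫ g ≫ 𝟙 (D.obj b) = π (e (e.symm t)) ⟨b, hb⟩
      rw [Category.comp_id]
    · exact Iff.rfl
  · intro W L π _
    obtain ⟨D', hD', ⟨F⟩⟩ := hD
    refine ⟨D', by simpa using hD', ⟨⟨Sum.elim F.φ PEmpty.elim, ?_, ?_, ?_⟩⟩⟩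
    · rintro (a | t) (b | s) h
      · exact congrArg _ (F.inj h)
      all_goals exact PEmpty.elim ‹_›
    · rintro (a | t)
      · exact F.θ a
      · exact t.elim
    · rintro (a | t) (b | s) g
      · exact F.rel_iff a b g
      all_goals exact PEmpty.elim ‹_›
  · intro T _ ih W L π h
    obtain ⟨D', hD', ⟨F⟩⟩ := ih (fun t => W (some t)) (fun t => L (some t)) (fun t => π (some t))
      (fun t => h (some t))
    -- The new limit is over a subdiagram of the original `D`, so the vertices adjoined before it
    -- play no role.
    obtain ⟨π', hπ', hc⟩ := F.ofExtend.isLimitCone (h none)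
    refine ⟨_, ?_, ⟨F.option π' hc⟩⟩
    rw [Finite.card_option, ← add_assoc]
    exact hD'.lim _ _ _ hπ'

/-- The colimit of a full subdiagram of a computed diagram has complexity at most one more. -/
theorem Computes.mixedComplexity_le {A : MorphismProperty C} {D : RelDiagram C} {c : ℕ}
    (hD : D.Computes A c) (W : Set D.V) (L : C) (ι : ∀ a : W, D.obj a ⟶ L)
    (h : D.IsColimitCocone W L ι) : mixedComplexity A L ≤ ((c + 1 : ℕ) : ℕ∞) := by
  obtain ⟨D', hD', ⟨F⟩⟩ := hD
  obtain ⟨ι', hι'⟩ := F.isColimitCocone h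
  refine iInf_le_of_le _ (iInf_le_of_le _ (iInf_le_of_le (hD'.colim _ _ _ hι')
    (iInf_le_of_le ?_ le_rfl)))
  exact ⟨fun _ => none, fun {a b} e => Empty.elim e, fun _ => Iso.refl _,
    fun _ _ _ => rfl, fun _ _ e => Empty.elim e, fun _ _ e => Empty.elim e⟩

end RelDiagram

/-! ## Diagrams over a set of variables -/

/-- A diagram whose vertices are variables, all with the object `B` and without outgoing edges, and
further vertices `κ`, called constraints. -/
structure VarDiagram (C : Type u) [Category.{v} C] (B : C) (ι : Type) where
  κ : Type
  obj : κ → C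
  toVar : ∀ (t : κ), ι → (obj t ⟶ B) → Prop
  toCon : ∀ (t s : κ), (obj t ⟶ obj s) → Prop

namespace VarDiagram

variable {C : Type u} [Category.{v} C] {B : C} {ι : Type}

/-- The underlying diagram. -/
def toRel (X : VarDiagram C B ι) : RelDiagram C where
  V := ι ⊕ X.κ
  obj := Sum.elim (fun _ => B) X.obj
  rel
    | .inr t, .inl i => X.toVar t i
    | .inr t, .inr s => X.toCon t s
    | .inl _, _ => fun _ => False

/-- `L` with the morphisms `p` and `q` is the limit of the full subdiagram on the variables `I` and
the constraints `K`, between which there are no edges. -/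
structure IsLimit (X : VarDiagram C B ι) (I : Set ι) (K : Set X.κ) (L : C)
    (p : ∀ i ∈ I, L ⟶ B) (q : ∀ s ∈ K, L ⟶ X.obj s) : Prop where
  no_con : ∀ s ∈ K, ∀ s' ∈ K, ∀ e, ¬ X.toCon s s' e
  cone : ∀ s hs i hi e, X.toVar s i e → q s hs ≫ e = p i hi
  univ : ∀ (M : C) (a : ∀ i ∈ I, M ⟶ B) (b : ∀ s ∈ K, M ⟶ X.obj s),
    (∀ s hs i hi e, X.toVar s i e → b s hs ≫ e = a i hi) →
      ∃! h : M ⟶ L, (∀ i hi, h ≫ p i hi = a i hi) ∧ ∀ s hs, h ≫ q s hs = b s hs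

/-- The set of vertices given by the variables `I` and the constraints `K`. -/
def vertexSet (X : VarDiagram C B ι) (I : Set ι) (K : Set X.κ) : Set X.toRel.V :=
  {a | Sum.elim (· ∈ I) (· ∈ K) a}

/-- A family of morphisms out of `L` to the vertices of `X.vertexSet I K`. -/
def toVertexSet (X : VarDiagram C B ι) {I : Set ι} {K : Set X.κ} {L : C}
    (p : ∀ i ∈ I, L ⟶ B) (q : ∀ s ∈ K, L ⟶ X.obj s) : ∀ a : X.vertexSet I K, L ⟶ X.toRel.obj a
  | ⟨.inl i, h⟩ => p i h
  | ⟨.inr s, h⟩ => q s h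

/-- The only edges inside `X.vertexSet I K` run from constraints to variables: variables have no
outgoing edges, and `no_con` excludes edges between constraints. -/
lemma IsLimit.isLimitCone {X : VarDiagram C B ι} {I : Set ι} {K : Set X.κ} {L : C}
    {p : ∀ i ∈ I, L ⟶ B} {q : ∀ s ∈ K, L ⟶ X.obj s} (h : X.IsLimit I K L p q) :
    X.toRel.IsLimitCone (X.vertexSet I K) L (X.toVertexSet p q) := by
  refine ⟨?_, fun M φ hφ => ?_⟩
  · rintro ⟨i | s, ha⟩ ⟨j | s', hb⟩ e he
    · exact he.elim
    · exact he.elim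
    · exact h.cone s ha j hb e he
    · exact (h.no_con s ha s' hb e he).elim
  · obtain ⟨g, ⟨hg, hg'⟩, hu⟩ := h.univ M (fun i hi => φ ⟨.inl i, hi⟩) (fun s hs => φ ⟨.inr s, hs⟩)
      (fun s hs i hi e he => hφ ⟨.inr s, hs⟩ ⟨.inl i, hi⟩ e he)
    refine ⟨g, ?_, fun g' hg' => hu g'
      ⟨fun i hi => hg' ⟨.inl i, hi⟩, fun s hs => hg' ⟨.inr s, hs⟩⟩⟩
    rintro ⟨i | s, ha⟩
    · exact hg i ha
    · exact hg' s ha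

/-- A limit can be described by the values of the variables alone, if each constraint is determined
by these values. -/
lemma exists_isLimit (X : VarDiagram C B ι) (I : Set ι) (K : Set X.κ) (L : C) (p : ∀ i ∈ I, L ⟶ B)
    (no_con : ∀ s ∈ K, ∀ s' ∈ K, ∀ e, ¬ X.toCon s s' e)
    (hex : ∀ s ∈ K, ∃ g : L ⟶ X.obj s, ∀ i hi e, X.toVar s i e → g ≫ e = p i hi)
    (mono : ∀ s ∈ K, ∀ (M : C) (g g' : M ⟶ X.obj s),
      (∀ i ∈ I, ∀ e, X.toVar s i e → g ≫ e = g' ≫ e) → g = g')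
    (univ : ∀ (M : C) (a : ∀ i ∈ I, M ⟶ B),
      (∀ s ∈ K, ∃ g : M ⟶ X.obj s, ∀ i hi e, X.toVar s i e → g ≫ e = a i hi) →
        ∃! h : M ⟶ L, ∀ i hi, h ≫ p i hi = a i hi) :
    ∃ q, X.IsLimit I K L p q := by
  choose q hq using hex
  refine ⟨q, no_con, hq, fun M a b hab => ?_⟩
  obtain ⟨h, hh, hu⟩ := univ M a (fun s hs => ⟨b s hs, hab s hs⟩)
  refine ⟨h, ⟨hh, fun s hs => mono s hs M _ _ fun i hi e he => ?_⟩, fun h' hh' => hu h' hh'.1⟩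
  rw [Category.assoc, hq s hs i hi e he, hh, hab s hs i hi e he]

/-- Limits over finitely many variables and constraints exist. -/
lemma exists_isLimit_of_finite [Limits.HasFiniteLimits C] (X : VarDiagram C B ι)
    (I : Set ι) (K : Set X.κ) [Finite I] [Finite K]
    (no_con : ∀ s ∈ K, ∀ s' ∈ K, ∀ e, ¬ X.toCon s s' e)
    (hfin : ∀ s i, {e | X.toVar s i e}.Finite) : ∃ L p q, X.IsLimit I K L p q := by
  let E := Σ (s : K) (i : I), {e : X.obj s ⟶ B | X.toVar s i e}
  have (s : K) (i : I) : Finite {e : X.obj s ⟶ B | X.toVar s i e} := (hfin s i).to_subtype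
  have : Finite E := inferInstance
  let P := Limits.prod (∏ᶜ fun _ : I => B) (∏ᶜ fun s : K => X.obj s)
  let f : P ⟶ ∏ᶜ fun _ : E => B :=
    Limits.Pi.lift fun x => Limits.prod.snd ≫ Limits.Pi.π (fun s : K => X.obj s) x.1 ≫ x.2.2.1
  let g : P ⟶ ∏ᶜ fun _ : E => B :=
    Limits.Pi.lift fun x => Limits.prod.fst ≫ Limits.Pi.π (fun _ : I => B) x.2.1
  refine ⟨Limits.equalizer f g,
    fun i hi => Limits.equalizer.ι f g ≫ Limits.prod.fst ≫ Limits.Pi.π (fun _ : I => B) ⟨i, hi⟩,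
    fun s hs => Limits.equalizer.ι f g ≫ Limits.prod.snd ≫
      Limits.Pi.π (fun s : K => X.obj s) ⟨s, hs⟩, no_con, ?_, ?_⟩
  · intro s hs i hi e he
    have := Limits.equalizer.condition f g =≫ Limits.Pi.π (fun _ : E => B) ⟨⟨s, hs⟩, ⟨i, hi⟩, e, he⟩
    simpa [f, g] using this
  · intro M a b hab
    have hk : Limits.prod.lift (Limits.Pi.lift fun i : I => a i i.2)
        (Limits.Pi.lift fun s : K => b s s.2) ≫ f = Limits.prod.lift
          (Limits.Pi.lift fun i : I => a i i.2) (Limits.Pi.lift fun s : K => b s s.2) ≫ g := by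
      refine Limits.Pi.hom_ext _ _ fun x => ?_
      simpa [f, g, Limits.prod.lift_fst_assoc, Limits.prod.lift_snd_assoc] using hab x.1 x.1.2 x.2.1 x.2.1.2 x.2.2.1 x.2.2.2
    refine ⟨Limits.equalizer.lift _ hk, ⟨fun i hi => by simp [Limits.prod.lift_fst_assoc],
      fun s hs => by simp [Limits.prod.lift_snd_assoc]⟩, ?_⟩
    rintro h ⟨h1, h2⟩
    refine Limits.equalizer.hom_ext (Limits.prod.hom_ext (Limits.Pi.hom_ext _ _ fun i => ?_)
      (Limits.Pi.hom_ext _ _ fun s => ?_))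
    · simpa [Limits.prod.lift_fst_assoc] using h1 i i.2
    · simpa [Limits.prod.lift_snd_assoc] using h2 s s.2

/-- The diagram `X` with a family of limits of full subdiagrams. -/
def extend (X : VarDiagram C B ι) {T : Type} (I : T → Set ι) (K : T → Set X.κ) (L : T → C)
    (p : ∀ (t : T), ∀ i ∈ I t, L t ⟶ B) (q : ∀ (t : T), ∀ s ∈ K t, L t ⟶ X.obj s) :
    VarDiagram C B ι where
  κ := X.κ ⊕ T
  obj := Sum.elim X.obj L
  toVar
    | .inl s, i => X.toVar s i
    | .inr t, i => fun e => ∃ hi : i ∈ I t, e = p t i hi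
  toCon
    | .inl s, .inl s' => X.toCon s s'
    | .inr t, .inl s => fun e => ∃ hs : s ∈ K t, e = q t s hs
    | _, .inr _ => fun _ => False

theorem computes_extend {A : MorphismProperty C} {X : VarDiagram C B ι} {c : ℕ}
    (hX : X.toRel.Computes A c) {T : Type} [Finite T] (I : T → Set ι) (K : T → Set X.κ) (L : T → C)
    (p : ∀ (t : T), ∀ i ∈ I t, L t ⟶ B) (q : ∀ (t : T), ∀ s ∈ K t, L t ⟶ X.obj s)
    (h : ∀ t, X.IsLimit (I t) (K t) (L t) (p t) (q t)) :
    (X.extend I K L p q).toRel.Computes A (c + Nat.card T) := by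
  obtain ⟨D', hD', ⟨F⟩⟩ := hX.extend (fun t => X.vertexSet (I t) (K t)) L
    (fun t => X.toVertexSet (p t) (q t)) (fun t => (h t).isLimitCone)
  refine ⟨D', hD', ⟨F.comap (Equiv.sumAssoc ι X.κ T).symm (Equiv.injective _)
    (fun a => match a with
      | .inl _ => Iso.refl _
      | .inr (.inl _) => Iso.refl _
      | .inr (.inr _) => Iso.refl _) ?_⟩⟩
  rintro (i | s | t) (j | s' | t') g
  · exact Iff.rfl
  · exact Iff.rfl
  · exact Iff.rfl
  · change X.obj s ⟶ B at g
    change X.toVar s j g ↔ X.toVar s j (𝟙 _ ≫ g ≫ 𝟙 _)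
    rw [Category.id_comp, Category.comp_id]
  · change X.obj s ⟶ X.obj s' at g
    change X.toCon s s' g ↔ X.toCon s s' (𝟙 _ ≫ g ≫ 𝟙 _)
    rw [Category.id_comp, Category.comp_id]
  · exact Iff.rfl
  · change L t ⟶ B at g
    change (∃ h : j ∈ I t, g = p t j h) ↔ ∃ h : j ∈ I t, 𝟙 _ ≫ g ≫ 𝟙 _ = p t j h
    rw [Category.id_comp, Category.comp_id]
  · change L t ⟶ X.obj s' at g
    change (∃ h : s' ∈ K t, g = q t s' h) ↔ ∃ h : s' ∈ K t, 𝟙 _ ≫ g ≫ 𝟙 _ = q t s' h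
    rw [Category.id_comp, Category.comp_id]
  · exact Iff.rfl

/-- A colimit of constraints has complexity at most one more than the diagram. -/
theorem mixedComplexity_le {A : MorphismProperty C} {X : VarDiagram C B ι} {c : ℕ}
    (hX : X.toRel.Computes A c) (K : Set X.κ) (L : C) (r : ∀ s ∈ K, X.obj s ⟶ L)
    (cocone : ∀ s hs s' hs' e, X.toCon s s' e → e ≫ r s' hs' = r s hs)
    (univ : ∀ (M : C) (b : ∀ s ∈ K, X.obj s ⟶ M),
      (∀ s hs s' hs' e, X.toCon s s' e → e ≫ b s' hs' = b s hs) →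
        ∃! h : L ⟶ M, ∀ s hs, r s hs ≫ h = b s hs) :
    mixedComplexity A L ≤ ((c + 1 : ℕ) : ℕ∞) := by
  refine hX.mixedComplexity_le (X.vertexSet ∅ K) L
    (fun a => match a with
      | ⟨.inl _, h⟩ => h.elim
      | ⟨.inr s, h⟩ => r s h) ⟨?_, fun M φ hφ => ?_⟩
  · rintro ⟨i | s, ha⟩ ⟨j | s', hb⟩ e he
    · exact ha.elim
    · exact ha.elim
    · exact hb.elim
    · exact cocone s ha s' hb e he
  · obtain ⟨g, hg, hu⟩ := univ M (fun s hs => φ ⟨.inr s, hs⟩)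
      (fun s hs s' hs' e he => hφ ⟨.inr s, hs⟩ ⟨.inr s', hs'⟩ e he)
    refine ⟨g, ?_, fun g' hg' => hu g' fun s hs => hg' ⟨.inr s, hs⟩⟩
    rintro ⟨i | s, ha⟩
    · exact ha.elim
    · exact hg s ha

end VarDiagram

/-! ## Functions on schemes over a field, and morphisms to affine schemes -/

section Functions

/-- The ring homomorphism given by a morphism to a spectrum. -/
def ringPull {X : Scheme.{u}} {A : Type u} [CommRing A] (g : X ⟶ Spec (CommRingCat.of A)) :
    A →+* Γ(X, ⊤) :=
  ((Scheme.ΓSpecIso (CommRingCat.of A)).inv ≫ g.appTop).hom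

lemma ringPull_comp {X Y : Scheme.{u}} {A : Type u} [CommRing A] (h : Y ⟶ X)
    (g : X ⟶ Spec (CommRingCat.of A)) : ringPull (h ≫ g) = h.appTop.hom.comp (ringPull g) := by
  rw [ringPull, ringPull, Scheme.Hom.comp_appTop, ← Category.assoc, CommRingCat.hom_comp]

lemma ringPull_specMap {X : Scheme.{u}} {A B : Type u} [CommRing A] [CommRing B] (φ : A →+* B)
    (g : X ⟶ Spec (CommRingCat.of B)) :
    ringPull (g ≫ Spec.map (CommRingCat.ofHom φ)) = (ringPull g).comp φ := by
  rw [ringPull, ringPull, Scheme.Hom.comp_appTop, ← Category.assoc,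
    ← Scheme.ΓSpecIso_inv_naturality, Category.assoc, CommRingCat.hom_comp, CommRingCat.hom_ofHom]

lemma ringPull_injective {X : Scheme.{u}} {A : Type u} [CommRing A] :
    Function.Injective (ringPull : (X ⟶ Spec (CommRingCat.of A)) → (A →+* Γ(X, ⊤))) :=
  fun _ _ h => ext_to_Spec (CommRingCat.hom_ext h)

lemma ringPull_lift {X : Scheme.{u}} {A : Type u} [CommRing A] (φ : A →+* Γ(X, ⊤)) :
    ringPull (X.toSpecΓ ≫ Spec.map (CommRingCat.ofHom φ)) = φ := by
  rw [ringPull, Scheme.Hom.comp_appTop, ← Category.assoc, ← Scheme.ΓSpecIso_inv_naturality,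
    Category.assoc, Scheme.toSpecΓ_appTop, Iso.inv_hom_id, Category.comp_id, CommRingCat.hom_ofHom]

variable {k : Type u} [Field k]

/-- The algebra of global functions on a scheme over `k`. -/
abbrev Fn (M : SchemeOver k) : Type u := Γ(M.left, ⊤)

instance (M : SchemeOver k) : Algebra k (Fn M) := (ringPull (A := k) M.hom).toAlgebra

/-- The spectrum of a `k`-algebra, as a scheme over `k`. -/
def specOver (A : Type u) [CommRing A] [Algebra k A] : SchemeOver k :=
  Over.mk (Spec.map (CommRingCat.ofHom (algebraMap k A)))

variable {A A' : Type u} [CommRing A] [Algebra k A] [CommRing A'] [Algebra k A']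

/-- The morphism of spectra induced by a homomorphism of `k`-algebras. -/
def specOverMap (α : A →ₐ[k] A') : specOver (k := k) A' ⟶ specOver A :=
  Over.homMk (Spec.map (CommRingCat.ofHom α.toRingHom)) (by
    change Spec.map _ ≫ Spec.map _ = Spec.map _
    rw [← Spec.map_comp, ← CommRingCat.ofHom_comp]
    congr 2
    exact α.comp_algebraMap)

/-- Pullback of functions. -/
def Fn.map {M N : SchemeOver k} (g : M ⟶ N) : Fn N →ₐ[k] Fn M where
  toRingHom := g.left.appTop.hom
  commutes' r := by
    have h : ringPull (A := k) (g.left ≫ N.hom) = ringPull M.hom := congrArg _ (Over.w g)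
    rw [ringPull_comp] at h
    exact congr($h r)

/-- The homomorphism of algebras given by a morphism to a spectrum. -/
def pullFn {M : SchemeOver k} (g : M ⟶ specOver A) : A →ₐ[k] Fn M where
  toRingHom := ringPull (A := A) g.left
  commutes' r := by
    have h : ringPull (A := k) (g.left ≫ (specOver A).hom) = ringPull M.hom :=
      congrArg _ (Over.w g)
    have h' := (ringPull_specMap (algebraMap k A) g.left).symm.trans h
    exact congr($h' r)

/-- The morphism to a spectrum given by a homomorphism of algebras. -/
def liftFn {M : SchemeOver k} (α : A →ₐ[k] Fn M) : M ⟶ specOver A :=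
  Over.homMk (M.left.toSpecΓ ≫ Spec.map (CommRingCat.ofHom α.toRingHom)) (by
    refine ringPull_injective (A := k) ?_
    refine (ringPull_specMap (algebraMap k A) _).trans ?_
    exact (congrArg (·.comp (algebraMap k A)) (ringPull_lift α.toRingHom)).trans
      α.comp_algebraMap)

lemma pullFn_liftFn {M : SchemeOver k} (α : A →ₐ[k] Fn M) : pullFn (liftFn α) = α :=
  AlgHom.ext fun x => congr($(ringPull_lift α.toRingHom) x)

lemma pullFn_injective {M : SchemeOver k} :
    Function.Injective (pullFn : (M ⟶ specOver A) → (A →ₐ[k] Fn M)) := fun _ _ h =>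
  Over.OverMorphism.ext (ringPull_injective (A := A) (RingHom.ext fun x => congr($h x)))

lemma pullFn_comp {M N : SchemeOver k} (h : M ⟶ N) (g : N ⟶ specOver A) :
    pullFn (h ≫ g) = (Fn.map h).comp (pullFn g) :=
  AlgHom.ext fun x => congr($(ringPull_comp (A := A) h.left g.left) x)

lemma pullFn_specOverMap {M : SchemeOver k} (g : M ⟶ specOver A') (α : A →ₐ[k] A') :
    pullFn (g ≫ specOverMap α) = (pullFn g).comp α :=
  AlgHom.ext fun x => congr($(ringPull_specMap (A := A) (B := A') α.toRingHom g.left) x)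

lemma liftFn_pullFn {M : SchemeOver k} (g : M ⟶ specOver A) : liftFn (pullFn g) = g :=
  pullFn_injective (pullFn_liftFn _)

/-- The coordinates of a point of affine space. -/
def coords {M : SchemeOver k} {d : ℕ} (g : M ⟶ affSpace k d) (i : Fin d) : Fn M :=
  pullFn (A := MvPolynomial (Fin d) k) g (MvPolynomial.X i)

/-- The point of affine space with given coordinates. -/
def ofCoords {M : SchemeOver k} {d : ℕ} (x : Fin d → Fn M) : M ⟶ affSpace k d :=
  liftFn (A := MvPolynomial (Fin d) k) (MvPolynomial.aeval x)

@[simp]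
lemma coords_ofCoords {M : SchemeOver k} {d : ℕ} (x : Fin d → Fn M) : coords (ofCoords x) = x := by
  ext i
  exact congr($(pullFn_liftFn (A := MvPolynomial (Fin d) k) (MvPolynomial.aeval x))
    (MvPolynomial.X i)).trans (MvPolynomial.aeval_X _ _)

lemma pullFn_eq_aeval_coords {M : SchemeOver k} {d : ℕ} (g : M ⟶ affSpace k d) :
    pullFn (A := MvPolynomial (Fin d) k) g = MvPolynomial.aeval (coords g) :=
  MvPolynomial.algHom_ext fun i => by
    rw [MvPolynomial.aeval_X]
    rfl

lemma coords_injective {M : SchemeOver k} {d : ℕ} :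
    Function.Injective (coords : (M ⟶ affSpace k d) → Fin d → Fn M) := fun g g' h =>
  pullFn_injective (A := MvPolynomial (Fin d) k)
    (by rw [pullFn_eq_aeval_coords, pullFn_eq_aeval_coords, h])

lemma coords_comp {M N : SchemeOver k} {d : ℕ} (h : M ⟶ N) (g : N ⟶ affSpace k d) (i : Fin d) :
    coords (h ≫ g) i = Fn.map h (coords g i) :=
  congr($(pullFn_comp (A := MvPolynomial (Fin d) k) h g) (MvPolynomial.X i))

lemma coords_affMap {M : SchemeOver k} {d e : ℕ} (g : M ⟶ affSpace k d)
    (p : Fin e → MvPolynomial (Fin d) k) (i : Fin e) :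
    coords (g ≫ affMap k p) i = MvPolynomial.aeval (coords g) (p i) := by
  have h := congr($(pullFn_specOverMap (A := MvPolynomial (Fin e) k)
    (A' := MvPolynomial (Fin d) k) g (MvPolynomial.aeval p)) (MvPolynomial.X i))
  rw [pullFn_eq_aeval_coords, AlgHom.comp_apply, MvPolynomial.aeval_X] at h
  exact h

instance : Limits.HasFiniteLimits (SchemeOver k) := inferInstance

/-- The coordinate of a point of the affine line. -/
abbrev coord {M : SchemeOver k} (g : M ⟶ affSpace k 1) : Fn M := coords g 0

/-- The point of the affine line with a given coordinate. -/
abbrev ofCoord {M : SchemeOver k} (x : Fn M) : M ⟶ affSpace k 1 := ofCoords fun _ => x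

lemma coord_injective {M : SchemeOver k} :
    Function.Injective (coord : (M ⟶ affSpace k 1) → Fn M) := fun g g' h =>
  coords_injective (funext fun i => by rwa [Subsingleton.elim i 0])

lemma coord_ofCoord {M : SchemeOver k} (x : Fn M) : coord (ofCoord x) = x :=
  congrFun (coords_ofCoords _) 0

lemma coord_comp_ofCoord {M N : SchemeOver k} (g : M ⟶ N) (x : Fn N) :
    coord (g ≫ ofCoord x) = Fn.map g x := by
  rw [coord, coords_comp, coords_ofCoords]

end Functions

/-- Extension by zero, so that values given only on `I` can be handled as a total assignment. -/
lemma exists_eq_total {α R : Type*} [Zero R] {I : Set α} (f : ∀ i ∈ I, R) :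
    ∃ v : α → R, ∀ i hi, f i hi = v i := by
  classical
  exact ⟨fun i => if hi : i ∈ I then f i hi else 0, fun i hi => (dif_pos hi).symm⟩

/-! ## Diagrams of affine spaces defined by polynomial constraints -/

section Constraints

variable {k : Type u} [Field k] {ι : Type}

namespace VarDiagram

/-- The values `v` of the variables in `I` at the points of `M` come from a point of the
constraint `s`. -/
def Sat (X : VarDiagram (SchemeOver k) (affSpace k 1) ι) (I : Set ι) (s : X.κ) {M : SchemeOver k}
    (v : ι → Fn M) : Prop :=
  ∃ g : M ⟶ X.obj s, ∀ i ∈ I, ∀ e, X.toVar s i e → coord (g ≫ e) = v i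

/-- A point of the constraint `s` is determined by the values of the variables in `I`. -/
def Determined (X : VarDiagram (SchemeOver k) (affSpace k 1) ι) (I : Set ι) (s : X.κ) : Prop :=
  ∀ (M : SchemeOver k) (g g' : M ⟶ X.obj s),
    (∀ i ∈ I, ∀ e, X.toVar s i e → coord (g ≫ e) = coord (g' ≫ e)) → g = g'

/-- Recognizes a limit by its functor of points: `L` must represent the assignments on `I` that
satisfy `K`. As points of the constraints are determined by visible values, the legs to `K` need
only exist. -/
lemma exists_isLimit_of_values (X : VarDiagram (SchemeOver k) (affSpace k 1) ι) (I : Set ι)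
    (K : Set X.κ) (L : SchemeOver k) (v : ι → Fn L)
    (no_con : ∀ s ∈ K, ∀ s' ∈ K, ∀ e, ¬ X.toCon s s' e)
    (det : ∀ s ∈ K, X.Determined I s) (sat : ∀ s ∈ K, X.Sat I s v)
    (univ : ∀ (M : SchemeOver k) (a : ι → Fn M), (∀ s ∈ K, X.Sat I s a) →
      ∃! h : M ⟶ L, ∀ i ∈ I, Fn.map h (v i) = a i) :
    ∃ q, X.IsLimit I K L (fun i _ => ofCoord (v i)) q := by
  classical
  refine X.exists_isLimit I K L _ no_con ?_ ?_ ?_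
  · intro s hs
    obtain ⟨g, hg⟩ := sat s hs
    exact ⟨g, fun i hi e he => coord_injective
      ((hg i hi e he).trans (coord_ofCoord _).symm)⟩
  · exact fun s hs M g g' h => det s hs M g g' fun i hi e he => congrArg coord (h i hi e he)
  · intro M a ha
    obtain ⟨a', ha'⟩ := exists_eq_total fun i hi => coord (a i hi)
    obtain ⟨h, hh, hu⟩ := univ M a' fun s hs => by
      obtain ⟨g, hg⟩ := ha s hs
      exact ⟨g, fun i hi e he => by rw [hg i hi e he, ha' i hi]⟩
    refine ⟨h, fun i hi => coord_injective ?_, fun h' hh' => hu h' fun i hi => ?_⟩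
    · rw [coord_comp_ofCoord, hh i hi, ← ha' i hi]
    · rw [← coord_comp_ofCoord, hh' i hi, ← ha' i hi]

lemma IsLimit.sat {X : VarDiagram (SchemeOver k) (affSpace k 1) ι} {I : Set ι} {K : Set X.κ}
    {L : SchemeOver k} {p : ∀ i ∈ I, L ⟶ affSpace k 1} {q : ∀ s ∈ K, L ⟶ X.obj s}
    (h : X.IsLimit I K L p q) {M : SchemeOver k} (g : M ⟶ L) {v : ι → Fn M}
    (hv : ∀ i hi, coord (g ≫ p i hi) = v i) {s : X.κ} (hs : s ∈ K) : X.Sat I s v :=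
  ⟨g ≫ q s hs, fun i hi e he => by rw [Category.assoc, h.cone s hs i hi e he, hv]⟩

lemma IsLimit.exists_hom {X : VarDiagram (SchemeOver k) (affSpace k 1) ι} {I : Set ι} {K : Set X.κ}
    {L : SchemeOver k} {p : ∀ i ∈ I, L ⟶ affSpace k 1} {q : ∀ s ∈ K, L ⟶ X.obj s}
    (h : X.IsLimit I K L p q) {M : SchemeOver k} {v : ι → Fn M} (hv : ∀ s ∈ K, X.Sat I s v) :
    ∃ g : M ⟶ L, ∀ i hi, coord (g ≫ p i hi) = v i := by
  choose b hb using hv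
  obtain ⟨g, hg, -⟩ := h.univ M (fun i _ => ofCoord (v i)) b (fun s hs i hi e he =>
    coord_injective ((hb s hs i hi e he).trans (coord_ofCoord _).symm))
  exact ⟨g, fun i hi => by rw [hg.1, coord, coords_ofCoords]⟩

lemma IsLimit.hom_ext {X : VarDiagram (SchemeOver k) (affSpace k 1) ι} {I : Set ι} {K : Set X.κ}
    {L : SchemeOver k} {p : ∀ i ∈ I, L ⟶ affSpace k 1} {q : ∀ s ∈ K, L ⟶ X.obj s}
    (h : X.IsLimit I K L p q) (det : ∀ s ∈ K, X.Determined I s) {M : SchemeOver k} {g g' : M ⟶ L}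
    (hg : ∀ i hi, coord (g ≫ p i hi) = coord (g' ≫ p i hi)) : g = g' := by
  refine (h.univ M (fun i hi => g' ≫ p i hi) (fun s hs => g' ≫ q s hs) fun s hs i hi e he => by
    rw [Category.assoc, h.cone s hs i hi e he]).unique
      ⟨fun i hi => coord_injective (hg i hi), fun s hs => det s hs _ _ _ fun i hi e he => ?_⟩
      ⟨fun i hi => rfl, fun s hs => rfl⟩
  rw [Category.assoc, h.cone s hs i hi e he, Category.assoc, h.cone s hs i hi e he, hg]

end VarDiagram

/-- At most three basic morphisms out of an affine space, to variables, that are jointly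
injective on points. -/
structure PolyConstraint (k : Type u) [Field k] (ι : Type) where
  dim : ℕ
  arity : ℕ
  arity_le : arity ≤ 3
  poly : Fin arity → MvPolynomial (Fin dim) k
  target : Fin arity → ι
  basic : ∀ p, BasicMorphism k (affMap k ![poly p])
  inj : ∀ (R : Type u) [CommRing R] [Algebra k R] (x x' : Fin dim → R),
    (∀ p, MvPolynomial.aeval x (poly p) = MvPolynomial.aeval x' (poly p)) → x = x'

namespace PolyConstraint

/-- The values of the variables come from a point of the constraint. -/
def Holds (t : PolyConstraint k ι) {R : Type u} [CommRing R] [Algebra k R] (v : ι → R) : Prop :=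
  ∃ x : Fin t.dim → R, ∀ p, MvPolynomial.aeval x (t.poly p) = v (t.target p)

open MvPolynomial in
/-- Two variables are equal. -/
def eq (i j : ι) : PolyConstraint k ι where
  dim := 1
  arity := 2
  arity_le := by norm_num
  poly := ![C 1 * X 0, C 1 * X 0]
  target := ![i, j]
  basic p := by fin_cases p <;> exact BasicMorphism.scale 1
  inj R _ _ x x' h := by
    ext q
    rw [Subsingleton.elim q 0]
    simpa using h 0

open MvPolynomial in
/-- A variable has a given value. -/
def const (i : ι) (c : k) : PolyConstraint k ι where
  dim := 0
  arity := 1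
  arity_le := by norm_num
  poly := ![C c]
  target := ![i]
  basic p := by fin_cases p; exact BasicMorphism.point c
  inj R _ _ x x' h := Subsingleton.elim _ _

open MvPolynomial in
/-- The third variable is the product (`o = true`) or the sum (`o = false`) of the first two. -/
def binary (o : Bool) (i j l : ι) : PolyConstraint k ι where
  dim := 2
  arity := 3
  arity_le := le_rfl
  poly := ![X 0, X 1, if o then X 0 * X 1 else X 0 + X 1]
  target := ![i, j, l]
  basic p := by
    fin_cases p
    · exact BasicMorphism.fst
    · exact BasicMorphism.snd
    · cases o
      · exact BasicMorphism.add
      · exact BasicMorphism.mul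
  inj R _ _ x x' h := by
    ext q
    fin_cases q
    · simpa using h 0
    · simpa using h 1

variable {R : Type u} [CommRing R] [Algebra k R] (v : ι → R)

open MvPolynomial in
@[simp]
lemma holds_eq (i j : ι) : (eq (k := k) i j).Holds v ↔ v i = v j := by
  change (∃ x : Fin 1 → R, ∀ p : Fin 2,
    aeval x ((![C 1 * X 0, C 1 * X 0] : Fin 2 → MvPolynomial (Fin 1) k) p) = v (![i, j] p)) ↔ _
  simp only [Fin.forall_fin_two]
  refine ⟨fun ⟨x, h0, h1⟩ => h0.symm.trans h1, fun h => ⟨fun _ => v i, ?_, ?_⟩⟩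
  · simp
  · simp [h]

open MvPolynomial in
@[simp]
lemma holds_const (i : ι) (c : k) : (const i c).Holds v ↔ v i = algebraMap k R c := by
  change (∃ x : Fin 0 → R, ∀ p : Fin 1,
    aeval x ((![C c] : Fin 1 → MvPolynomial (Fin 0) k) p) = v (![i] p)) ↔ _
  simp [eq_comm]

open MvPolynomial in
@[simp]
lemma holds_binary (o : Bool) (i j l : ι) :
    (binary (k := k) o i j l).Holds v ↔ v l = if o then v i * v j else v i + v j := by
  change (∃ x : Fin 2 → R, ∀ p : Fin 3, aeval x ((![X 0, X 1, if o then X 0 * X 1 else X 0 + X 1] :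
    Fin 3 → MvPolynomial (Fin 2) k) p) = v (![i, j, l] p)) ↔ _
  constructor
  · rintro ⟨x, hx⟩
    have h0 : aeval x (X 0 : MvPolynomial (Fin 2) k) = v i := hx 0
    have h1 : aeval x (X 1 : MvPolynomial (Fin 2) k) = v j := hx 1
    have h2 : aeval x (if o then X 0 * X 1 else X 0 + X 1 : MvPolynomial (Fin 2) k) = v l := hx 2
    rw [← h0, ← h1, ← h2]
    cases o <;> simp
  · intro h
    refine ⟨![v i, v j], fun p => ?_⟩
    fin_cases p
    · simp
    · simp
    · cases o <;> simp [h]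

end PolyConstraint

variable {κ : Type} (t : κ → PolyConstraint k ι)

/-- The diagram of the variables and the constraints `t`. -/
def constraintDiagram : VarDiagram (SchemeOver k) (affSpace k 1) ι where
  κ := κ
  obj s := affSpace k (t s).dim
  toVar s i e := ∃ p, (t s).target p = i ∧ e = affMap k ![(t s).poly p]
  toCon _ _ _ := False

lemma finite_toVar_constraintDiagram (s : κ) (i : ι) :
    {e | (constraintDiagram t).toVar s i e}.Finite :=
  (Set.finite_range fun p => affMap k ![(t s).poly p]).subset
    (by rintro _ ⟨p, -, rfl⟩; exact ⟨p, rfl⟩)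

lemma coord_affMap {M : SchemeOver k} {d : ℕ} (g : M ⟶ affSpace k d)
    (p : MvPolynomial (Fin d) k) : coord (g ≫ affMap k ![p]) = MvPolynomial.aeval (coords g) p :=
  coords_affMap _ _ _

/-- The hypothesis says that no edge of `s` is cut off by passing to the full subdiagram; otherwise
`Sat` would be weaker than `Holds`. -/
lemma sat_constraintDiagram_iff {I : Set ι} {s : κ} (hs : ∀ p, (t s).target p ∈ I)
    {M : SchemeOver k} (v : ι → Fn M) : (constraintDiagram t).Sat I s v ↔ (t s).Holds v := by
  constructor
  · rintro ⟨g, hg⟩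
    refine ⟨coords (d := (t s).dim) g, fun p => ?_⟩
    rw [← hg _ (hs p) _ ⟨p, rfl, rfl⟩]
    exact (coord_affMap _ _).symm
  · rintro ⟨x, hx⟩
    refine ⟨ofCoords x, ?_⟩
    rintro _ - _ ⟨p, rfl, rfl⟩
    refine (coord_affMap (ofCoords x) _).trans ?_
    rw [coords_ofCoords, hx]

lemma determined_constraintDiagram {I : Set ι} {s : κ} (hs : ∀ p, (t s).target p ∈ I) :
    (constraintDiagram t).Determined I s := by
  intro M g g' h
  refine coords_injective ((t s).inj _ _ _ fun p => ?_)
  exact (coord_affMap _ _).symm.trans ((h _ (hs p) _ ⟨p, rfl, rfl⟩).trans (coord_affMap _ _))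

/-- The variables and the constraints `t`, as an initial diagram. -/
def constraintGraph : GraphDiagram (SchemeOver k) where
  V := ι ⊕ κ
  E
    | .inr s, .inl i => {p : Fin (t s).arity // (t s).target p = i}
    | _, _ => Empty
  obj := Sum.elim (fun _ => affSpace k 1) (fun s => affSpace k (t s).dim)
  map := fun {a b} => match a, b with
    | .inr s, .inl _ => fun p => affMap k ![(t s).poly p.1]
    | .inl _, _ => fun e => Empty.elim e
    | .inr _, .inr _ => fun e => Empty.elim e

/-- Only edges of the initial diagram are paid for, at most three per constraint. The two hypotheses
ensure that every vertex is an endpoint of an edge. -/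
theorem computes_constraintDiagram [Finite ι] [Finite κ]
    (hι : ∀ i, ∃ s p, (t s).target p = i) (hκ : ∀ s, 0 < (t s).arity) :
    ∃ c ≤ 3 * Nat.card κ, (constraintDiagram t).toRel.Computes (BasicMorphism k) c := by
  refine ⟨_, ?_, constraintGraph t, .init _ ⟨?_, ?_, ?_, ?_⟩,
    ⟨⟨id, Function.injective_id, fun a => Iso.refl _, ?_⟩⟩⟩
  · let F (x : Σ a b : (constraintGraph t).V, (constraintGraph t).E a b) : κ × Fin 3 :=
      match x with
      | ⟨.inr s, .inl _, p⟩ => (s, Fin.castLE (t s).arity_le p.1)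
      | ⟨.inl _, _, e⟩ => Empty.elim e
      | ⟨.inr _, .inr _, e⟩ => Empty.elim e
    -- An edge is determined by its constraint and its index there, the target variable being a
    -- function of these.
    have hF : Function.Injective F := by
      rintro ⟨i | s, j | s', e⟩ ⟨i' | r, j' | r', e'⟩ h <;>
        try first | exact Empty.elim e | exact Empty.elim e'
      obtain ⟨p, rfl⟩ := e
      obtain ⟨p', rfl⟩ := e'
      obtain ⟨h1, h2⟩ := Prod.ext_iff.1 h
      change s = r at h1
      subst h1
      obtain rfl := Fin.castLE_injective (t s).arity_le h2
      rfl
    refine (Nat.card_le_card_of_injective F hF).trans ?_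
    rw [Nat.card_prod, Nat.card_fin, mul_comm]
  · exact inferInstanceAs (Finite (ι ⊕ κ))
  · rintro (i | s) (j | s')
    · exact inferInstanceAs (Finite Empty)
    · exact inferInstanceAs (Finite Empty)
    · exact inferInstanceAs (Finite {p : Fin (t s).arity // (t s).target p = j})
    · exact inferInstanceAs (Finite Empty)
  · rintro (i | s) (j | s') e
    · exact Empty.elim e
    · exact Empty.elim e
    · exact (t s).basic _
    · exact Empty.elim e
  · rintro (i | s)
    · obtain ⟨s, p, h⟩ := hι i
      exact ⟨.inr s, .inr ⟨⟨p, h⟩⟩⟩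
    · exact ⟨.inl ((t s).target ⟨0, hκ s⟩), .inl ⟨⟨⟨0, hκ s⟩, rfl⟩⟩⟩
  · rintro (i | s) (j | s') g
    · exact ⟨fun h => h.elim, fun ⟨e, _⟩ => Empty.elim e⟩
    · exact ⟨fun h => h.elim, fun ⟨e, _⟩ => Empty.elim e⟩
    · change affSpace k (t s).dim ⟶ affSpace k 1 at g
      change (∃ p, (t s).target p = j ∧ g = affMap k ![(t s).poly p]) ↔
        ∃ p : {p // (t s).target p = j}, affMap k ![(t s).poly p.1] = 𝟙 _ ≫ g ≫ 𝟙 _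
      rw [Category.id_comp, Category.comp_id]
      exact ⟨fun ⟨p, hp, h⟩ => ⟨⟨p, hp⟩, h.symm⟩, fun ⟨p, h⟩ => ⟨p.1, p.2, h.symm⟩⟩
    · exact ⟨fun h => h.elim, fun ⟨e, _⟩ => Empty.elim e⟩

end Constraints

/-! ## Systems of gates of unbounded fan-in -/

section Gates

/-- The neutral element of addition (`o = false`) or multiplication (`o = true`). -/
def neutral (R : Type*) [CommRing R] (o : Bool) : R := if o then 1 else 0

/-- The sum (`o = false`) or product (`o = true`) over a finite set. -/
def fold {R : Type*} [CommRing R] (o : Bool) {α : Type*} (s : Finset α) (f : α → R) : R :=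
  if o then ∏ a ∈ s, f a else ∑ a ∈ s, f a

/-- The partial sums (`o = false`) or products (`o = true`) of a sequence. -/
def partialFold {R : Type*} [CommRing R] (o : Bool) {N : ℕ} (f : Fin N → R) (i : Fin (N + 1)) : R :=
  if o then Fin.partialProd f i else Fin.partialSum f i

section Fold

variable {R : Type*} [CommRing R] (o : Bool) {N : ℕ} (f : Fin N → R)

lemma partialFold_zero : partialFold o f 0 = neutral R o := by
  cases o <;> simp [partialFold, neutral]

lemma partialFold_succ (a : Fin N) : partialFold o f a.succ =
    if o then partialFold o f a.castSucc * f a else partialFold o f a.castSucc + f a := by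
  cases o <;> simp [partialFold, Fin.partialSum_succ, Fin.partialProd_succ]

lemma partialFold_last : partialFold o f (Fin.last N) = fold o Finset.univ f := by
  cases o
  · simp [partialFold, fold, Fin.partialSum, List.take_of_length_le, List.sum_ofFn]
  · simp [partialFold, fold, Fin.partialProd, List.take_of_length_le, List.prod_ofFn]

lemma eq_partialFold {s : Fin (N + 1) → R} (h0 : s 0 = neutral R o)
    (hs : ∀ a : Fin N, s a.succ = if o then s a.castSucc * f a else s a.castSucc + f a) :
    s = partialFold o f := by
  ext i
  induction i using Fin.induction with
  | zero => rw [h0, partialFold_zero]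
  | succ a ih => rw [hs, partialFold_succ, ih]

/-- Padding with neutral elements: this lets a chain of fixed length N compute a sum or product over
any subset. -/
lemma fold_ite {α : Type*} [Fintype α] [DecidableEq α] (s : Finset α) (f : α → R) :
    fold o Finset.univ (fun a => if a ∈ s then f a else neutral R o) = fold o s f := by
  cases o <;> simp [fold, neutral, Finset.sum_ite_mem, Finset.prod_ite_mem]

lemma fold_congr {α : Type*} {s : Finset α} {f g : α → R} (h : ∀ a ∈ s, f a = g a) :
    fold o s f = fold o s g := by
  cases o
  · exact Finset.sum_congr rfl h
  · exact Finset.prod_congr rfl h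

lemma map_fold {R' F : Type*} [CommRing R'] [FunLike F R R'] [RingHomClass F R R'] (φ : F)
    {α : Type*} (s : Finset α) (f : α → R) : φ (fold o s f) = fold o s fun a => φ (f a) := by
  cases o <;> simp [fold]

end Fold

/-- A value of a vertex with a given label is the right one, given the values of the inputs `x` and
of the predecessors `s` of the vertex. -/
def CircuitLabel.Holds {k : Type u} [Field k] {σ : Type} {R : Type*} [CommRing R] [Algebra k R]
    {N : ℕ} (x : σ → R) (y : Fin N → R) (s : Finset (Fin N)) (c : R) : CircuitLabel k σ → Prop
  | .var i => c = x i
  | .const r => c = algebraMap k R r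
  | .add => c = fold false s y
  | .mul => c = fold true s y

/-- Whether the label is `×`. -/
def CircuitLabel.isMul {k : Type u} {σ : Type} : CircuitLabel k σ → Bool
  | .mul => true
  | _ => false

/-- A circuit with `m` output vertices, with vertices numbered by `Fin N`. -/
structure GateSystem (k : Type u) [Field k] (σ : Type) (m N : ℕ) where
  label : Fin N → CircuitLabel k σ
  pred : Fin N → Finset (Fin N)
  wf : WellFounded fun a b => a ∈ pred b
  value : Fin N → MvPolynomial σ k
  holds_value : ∀ b, (label b).Holds MvPolynomial.X value (pred b) (value b)
  out : Fin m → Fin N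

variable {k : Type u} [Field k]

/-- Induction along the well-founded predecessor relation shows that the local conditions have at
most one solution. Evaluating the polynomials of the circuit at `x` gives one, because ring
homomorphisms commute with `fold`. -/
theorem GateSystem.holds_iff {σ : Type} {m N : ℕ} (G : GateSystem k σ m N) {R : Type*} [CommRing R]
    [Algebra k R] (x : σ → R) (y : Fin N → R) :
    (∀ b, (G.label b).Holds x y (G.pred b) (y b)) ↔ ∀ b, y b = MvPolynomial.aeval x (G.value b) := by
  have hv (b) : (G.label b).Holds x (fun a => MvPolynomial.aeval x (G.value a)) (G.pred b)
      (MvPolynomial.aeval x (G.value b)) := by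
    have := G.holds_value b
    revert this
    cases G.label b <;> intro h <;> rw [CircuitLabel.Holds] at h <;>
      simp [CircuitLabel.Holds, h, map_fold]
  constructor
  · intro h b
    induction b using G.wf.induction with
    | _ b ih =>
      have h1 := h b
      have h2 := hv b
      revert h1 h2
      cases G.label b <;> intro h1 h2 <;> rw [CircuitLabel.Holds] at h1 h2 <;> rw [h1, h2]
      · exact fold_congr _ ih
      · exact fold_congr _ ih
  · intro h
    obtain rfl : y = _ := funext h
    exact hv

/-- Circuits computing given polynomials, taken together. -/
theorem exists_gateSystem {σ : Type} {m : ℕ} (f : Fin m → MvPolynomial σ k) (c : Fin m → ℕ)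
    (h : ∀ i, ∃ Γ : ArithmeticCircuit k σ, Γ.size = c i ∧ Γ.Computes (f i)) :
    ∃ G : GateSystem k σ m (∑ i, c i), ∀ j, G.value (G.out j) = f j := by
  classical
  choose Γ hc p hp b hb using h
  -- The vertices are those of the disjoint union of the circuits, so their number is the sum of the
  -- sizes.
  let e : (Σ i, (Γ i).V) ≃ Fin (∑ i, c i) := Fintype.equivFinOfCardEq (by
    rw [Fintype.card_sigma]
    exact Finset.sum_congr rfl fun i _ => hc i)
  let E : (Σ i, (Γ i).V) → (Σ i, (Γ i).V) → Prop := fun x y =>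
    ∃ h : x.1 = y.1, (Γ y.1).E (h ▸ x.2) y.2
  let pv : (Σ i, (Γ i).V) → MvPolynomial σ k := fun z => p z.1 z.2
  have hE (i) (a b : (Γ i).V) : E ⟨i, a⟩ ⟨i, b⟩ ↔ (Γ i).E a b :=
    ⟨fun ⟨_, h⟩ => h, fun h => ⟨rfl, h⟩⟩
  have hfold (o : Bool) (i) (b : (Γ i).V) :
      fold o (Finset.univ.filter fun a => E (e.symm a) ⟨i, b⟩)
        (fun a => pv (e.symm a)) =
      fold o (Finset.univ.filter fun a => (Γ i).E a b) (p i) := by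
    have hmap : (Finset.univ.filter fun a => E (e.symm a) ⟨i, b⟩) =
        (Finset.univ.filter fun a => (Γ i).E a b).map
          ((Function.Embedding.sigmaMk i).trans e.toEmbedding) := by
      ext a
      obtain ⟨⟨j, a⟩, rfl⟩ := e.surjective a
      simp only [Equiv.symm_apply_apply, Finset.mem_filter, Finset.mem_univ, true_and,
        Finset.mem_map, Function.Embedding.trans_apply, Equiv.coe_toEmbedding,
        EmbeddingLike.apply_eq_iff_eq, Function.Embedding.sigmaMk_apply]
      constructor
      · rintro ⟨h, h'⟩
        obtain rfl : j = i := h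
        exact ⟨a, h', rfl⟩
      · rintro ⟨a', h, h'⟩
        rw [← h']
        exact (hE _ _ _).2 h
    rw [hmap]
    have hpv (a) : pv (e.symm (((Function.Embedding.sigmaMk i).trans e.toEmbedding) a)) = p i a :=
      congrArg pv (e.symm_apply_apply ⟨i, a⟩)
    cases o
    · exact (Finset.sum_map _ _ _).trans (Finset.sum_congr rfl fun a _ => hpv a)
    · exact (Finset.prod_map _ _ _).trans (Finset.prod_congr rfl fun a _ => hpv a)
  refine ⟨⟨fun v => (Γ (e.symm v).1).label (e.symm v).2,
    fun v => Finset.univ.filter fun a => E (e.symm a) (e.symm v), ?_,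
    fun v => pv (e.symm v), ?_, fun i => e ⟨i, b i⟩⟩, ?_⟩
  · have hwf (i) : WellFounded (Γ i).E := by
      have : Std.Irrefl (Relation.TransGen (Γ i).E) := ⟨(Γ i).acyclic⟩
      exact Subrelation.wf (fun {a b} h => .single h)
        (Finite.wellFounded_of_trans_of_irrefl (Relation.TransGen (Γ i).E))
    have hE' : WellFounded E := ⟨fun ⟨i, a⟩ => by
      induction a using (hwf i).induction with
      | _ a ih =>
        refine ⟨_, ?_⟩
        rintro ⟨j, x⟩ ⟨h, h'⟩
        obtain rfl : j = i := h
        exact ih x h'⟩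
    exact Subrelation.wf (fun {a b} h => by simpa [InvImage] using h) (InvImage.wf e.symm hE')
  · intro v
    have h1 := hp (e.symm v).1 (e.symm v).2
    have h2 (o) := hfold o (e.symm v).1 (e.symm v).2
    rw [ArithmeticCircuit.gateValue] at h1
    revert h1
    cases hl : (Γ (e.symm v).1).label (e.symm v).2 <;> intro h1 <;> simp only at h1 <;>
      refine h1.trans ?_
    · rfl
    · rfl
    · exact ((h2 false).trans (by simp [fold])).symm
    · exact ((h2 true).trans (by simp [fold])).symm
  · intro j
    simp [pv, hb]

end Gates

/-! ## The initial diagram of a system of gates, and its gates as limits -/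

section GateDiagram

/-- The variables of the diagram: coordinates `z` of the points of a chart, two copies `x` of them,
a scaling factor, the values `y` of the gates, and the inputs `w` and partial results `s` of a
universal sum (`false`) and product (`true`). -/
inductive ChartVar (n N : ℕ) : Type
  | scalar
  | x (o : Bool) (l : Fin (n + 1))
  | z (l : Fin (n + 1))
  | y (a : Fin N)
  | w (a : Fin N)
  | s (o : Bool) (i : Fin (N + 1))

/-- The constraints of the diagram. -/
inductive ChartCon (n m N : ℕ) : Type
  | scale (l : Fin (n + 1))
  | copy (o : Bool) (l : Fin (n + 1))
  | one (l : Fin (n + 1))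
  | init (o : Bool)
  | step (o : Bool) (a : Fin N)
  | neutral (o : Bool) (a : Fin N)
  | load (a : Fin N)
  | result (o : Bool) (b : Fin N)
  | leaf (b : Fin N)
  | out (j : Fin m)

instance (n N : ℕ) : Finite (ChartVar n N) := by
  let F : ChartVar n N → Unit ⊕ (Bool × Fin (n + 1)) ⊕ Fin (n + 1) ⊕ Fin N ⊕ Fin N ⊕
      (Bool × Fin (N + 1))
    | .scalar => .inl ()
    | .x o l => .inr (.inl (o, l))
    | .z l => .inr (.inr (.inl l))
    | .y a => .inr (.inr (.inr (.inl a)))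
    | .w a => .inr (.inr (.inr (.inr (.inl a))))
    | .s o i => .inr (.inr (.inr (.inr (.inr (o, i)))))
  refine Finite.of_injective F fun a b h => ?_
  cases a <;> cases b <;> simp_all [F]

/-- Constraints sorted by their kind. -/
def ChartCon.toSum {n m N : ℕ} : ChartCon n m N → Fin (n + 1) ⊕ (Bool × Fin (n + 1)) ⊕ Fin (n + 1) ⊕
    Bool ⊕ (Bool × Fin N) ⊕ (Bool × Fin N) ⊕ Fin N ⊕ (Bool × Fin N) ⊕ Fin N ⊕ Fin m
  | .scale l => .inl l
  | .copy o l => .inr (.inl (o, l))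
  | .one l => .inr (.inr (.inl l))
  | .init o => .inr (.inr (.inr (.inl o)))
  | .step o a => .inr (.inr (.inr (.inr (.inl (o, a)))))
  | .neutral o a => .inr (.inr (.inr (.inr (.inr (.inl (o, a))))))
  | .load a => .inr (.inr (.inr (.inr (.inr (.inr (.inl a))))))
  | .result o b => .inr (.inr (.inr (.inr (.inr (.inr (.inr (.inl (o, b))))))))
  | .leaf b => .inr (.inr (.inr (.inr (.inr (.inr (.inr (.inr (.inl b))))))))
  | .out j => .inr (.inr (.inr (.inr (.inr (.inr (.inr (.inr (.inr j))))))))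

lemma ChartCon.toSum_injective (n m N : ℕ) : Function.Injective (toSum : ChartCon n m N → _) := by
  intro a b h
  cases a <;> cases b <;> simp_all [toSum]

instance (n m N : ℕ) : Finite (ChartCon n m N) := .of_injective _ (ChartCon.toSum_injective n m N)

/-- The 4(n+1) counts `scale`, `one` and the two copies; the 2 counts `init`; the 8N counts `step`,
`neutral` and `result` twice each, and `load` and `leaf` once; `out` gives m. -/
lemma ChartCon.card_le (n m N : ℕ) :
    Nat.card (ChartCon n m N) ≤ 4 * (n + 1) + 2 + 8 * N + m := by
  refine (Nat.card_le_card_of_injective _ (ChartCon.toSum_injective n m N)).trans ?_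
  rw [Nat.card_eq_fintype_card]
  simp only [Fintype.card_sum, Fintype.card_prod, Fintype.card_bool, Fintype.card_fin]
  omega

variable {k : Type u} [Field k] {n m N : ℕ}

/-- The constraint for an input vertex of a circuit. -/
def CircuitLabel.con (b : Fin N) : CircuitLabel k (Fin (n + 1)) → PolyConstraint k (ChartVar n N)
  | .var i => .eq (.y b) (.z i)
  | .const c => .const (.y b) c
  -- A vacuous constraint at sum and product vertices, which keeps the family total; charts use
  -- `leaf b` only when the label is a leaf.
  | _ => .eq (.y b) (.y b)

lemma CircuitLabel.target_con (b : Fin N) (l : CircuitLabel k (Fin (n + 1))) (p) :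
    (∃ a, (l.con b).target p = .y a) ∨ ∃ i, (l.con b).target p = .z i := by
  cases l
  · change Fin 2 at p
    fin_cases p
    exacts [.inl ⟨_, rfl⟩, .inr ⟨_, rfl⟩]
  · change Fin 1 at p
    fin_cases p
    exact .inl ⟨_, rfl⟩
  all_goals
    change Fin 2 at p
    fin_cases p <;> exact .inl ⟨_, rfl⟩

lemma CircuitLabel.holds_con_iff {R : Type u} [CommRing R] [Algebra k R] {b : Fin N}
    {l : CircuitLabel k (Fin (n + 1))} (hl : l.IsLeaf) (v : ChartVar n N → R) (s : Finset (Fin N)) :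
    (l.con b).Holds v ↔ l.Holds (fun i => v (.z i)) (fun a => v (.y a)) s (v (.y b)) := by
  cases l
  · simp [con, Holds]
  · simp [con, Holds]
  · exact hl.elim
  · exact hl.elim

lemma CircuitLabel.holds_iff_of_not_isLeaf {R : Type u} [CommRing R] [Algebra k R]
    {l : CircuitLabel k (Fin (n + 1))} (hl : ¬ l.IsLeaf) (x : Fin (n + 1) → R) (y : Fin N → R)
    (s : Finset (Fin N)) (c : R) : l.Holds x y s c ↔ c = fold l.isMul s y := by
  cases l
  · exact (hl trivial).elim
  · exact (hl trivial).elim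
  · exact Iff.rfl
  · exact Iff.rfl

namespace GateSystem

variable (G : GateSystem k (Fin (n + 1)) m N)

/-- The polynomial constraints of the diagram. -/
def con : ChartCon n m N → PolyConstraint k (ChartVar n N)
  | .scale l => .binary true .scalar (.x false l) (.x true l)
  | .copy o l => .eq (.x o l) (.z l)
  | .one l => .const (.z l) 1
  | .init o => .const (.s o 0) (neutral k o)
  | .step o a => .binary o (.s o a.castSucc) (.w a) (.s o a.succ)
  | .neutral o a => .const (.w a) (neutral k o)
  | .load a => .eq (.w a) (.y a)
  | .result o b => .eq (.y b) (.s o (Fin.last N))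
  | .leaf b => (G.label b).con b
  | .out j => .const (.y (G.out j)) 0

/-- The diagram of the variables and the constraints. -/
abbrev base : VarDiagram (SchemeOver k) (affSpace k 1) (ChartVar n N) := constraintDiagram G.con

theorem computes_base :
    ∃ c ≤ 3 * (4 * (n + 1) + 2 + 8 * N + m), G.base.toRel.Computes (BasicMorphism k) c := by
  suffices H : (∀ i, ∃ s p, (G.con s).target p = i) ∧ ∀ s, 0 < (G.con s).arity by
    obtain ⟨c, hc, h⟩ := computes_constraintDiagram G.con H.1 H.2
    exact ⟨c, hc.trans (Nat.mul_le_mul_left 3 (ChartCon.card_le n m N)), h⟩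
  refine ⟨fun i => ?_, fun s => ?_⟩
  · cases i with
    | scalar => exact ⟨.scale 0, (0 : Fin 3), rfl⟩
    | x o l => exact ⟨.copy o l, (0 : Fin 2), rfl⟩
    | z l => exact ⟨.one l, (0 : Fin 1), rfl⟩
    | y a => exact ⟨.load a, (1 : Fin 2), rfl⟩
    | w a => exact ⟨.load a, (0 : Fin 2), rfl⟩
    | s o i =>
      cases i using Fin.cases with
      | zero => exact ⟨.init o, (0 : Fin 1), rfl⟩
      | succ a => exact ⟨.step o a, (2 : Fin 3), rfl⟩
  · cases s with
    | leaf b =>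
      rw [con]
      cases G.label b <;> simp [CircuitLabel.con, PolyConstraint.eq, PolyConstraint.const]
    | _ => simp [con, PolyConstraint.eq, PolyConstraint.const, PolyConstraint.binary]

/-- The variables on which a gate is defined. -/
def gateVars (b : Fin N) : Set (ChartVar n N) :=
  {i | match i with
    | .w _ => True
    | .s o _ => o = (G.label b).isMul
    | .y a => a ∈ G.pred b ∨ a = b
    | _ => False}

/-- The constraints that define a gate. -/
def gateCons (b : Fin N) : Set (ChartCon n m N) :=
  {s | match s with
    | .init o => o = (G.label b).isMul
    | .step o _ => o = (G.label b).isMul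
    | .neutral o a => o = (G.label b).isMul ∧ a ∉ G.pred b
    | .load a => a ∈ G.pred b
    | .result o c => o = (G.label b).isMul ∧ c = b
    | _ => False}

lemma target_mem_gateVars (b : Fin N) {s : ChartCon n m N} (hs : s ∈ G.gateCons b)
    (p) : (G.con s).target p ∈ G.gateVars b := by
  cases s with
  | init o =>
    change Fin 1 at p
    fin_cases p
    exact hs
  | step o a =>
    change Fin 3 at p
    fin_cases p
    exacts [hs, trivial, hs]
  | neutral o a =>
    change Fin 1 at p
    fin_cases p
    trivial
  | load a =>
    change Fin 2 at p
    fin_cases p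
    exacts [trivial, Or.inl hs]
  | result o c =>
    change Fin 2 at p
    fin_cases p
    exacts [Or.inr hs.2, hs.1]
  | _ => exact hs.elim

section

variable {R : Type u} [CommRing R] (b : Fin N)

open Classical in
/-- The inputs of the universal sum or product that is used for a gate. -/
def gateInput (y : Fin N → R) (a : Fin N) : R :=
  if a ∈ G.pred b then y a else neutral R (G.label b).isMul

/-- The values of the variables of a gate, given the values of its predecessors. -/
def gateFill (y : Fin N → R) : ChartVar n N → R
  | .w a => G.gateInput b y a
  | .s o i => partialFold o (G.gateInput b y) i
  | .y a => y a
  -- A default at variables outside `gateVars`.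
  | _ => 0

lemma fold_gateInput (y : Fin N → R) :
    fold (G.label b).isMul Finset.univ (G.gateInput b y) = fold (G.label b).isMul (G.pred b) y :=
  by classical exact fold_ite _ _ _

/-- The internal variables of a gate are functions of the values at the predecessors; this is what
makes a point of the gate determined by its visible values. -/
lemma gateFill_congr {y y' : Fin N → R} (h : ∀ a, a ∈ G.pred b ∨ a = b → y a = y' a)
    {i : ChartVar n N} (hi : i ∈ G.gateVars b) : G.gateFill b y i = G.gateFill b y' i := by
  have hin : G.gateInput b y = G.gateInput b y' := by
    ext a
    by_cases ha : a ∈ G.pred b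
    · simp [gateInput, ha, h a (.inl ha)]
    · simp [gateInput, ha]
  cases i with
  | y a => exact h a hi
  | w a => exact congrFun hin a
  | s o i => simp [gateFill, hin]
  | _ => rfl

variable [Algebra k R]

lemma algebraMap_neutral (o : Bool) : algebraMap k R (neutral k o) = neutral R o := by
  cases o <;> simp [neutral]

lemma holds_gateFill {y : Fin N → R} (hy : y b = fold (G.label b).isMul (G.pred b) y)
    {s : ChartCon n m N} (hs : s ∈ G.gateCons b) : (G.con s).Holds (G.gateFill b y) := by
  cases s with
  | init o => simp [con, gateFill, algebraMap_neutral, partialFold_zero]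
  | step o a => simp [con, gateFill, partialFold_succ]
  | neutral o a =>
    obtain ⟨rfl, ha⟩ := hs
    simp [con, gateFill, gateInput, ha, algebraMap_neutral]
  | load a =>
    have ha : a ∈ G.pred b := hs
    simp [con, gateFill, gateInput, ha]
  | result o c =>
    obtain ⟨rfl, rfl⟩ := hs
    simp [con, gateFill, partialFold_last, fold_gateInput, hy]
  | _ => exact hs.elim

/-- `load` and `neutral` fix all inputs of the chain, `init` and `step` then fix its partial
results, and `result` reads off the last one. Together with `holds_gateFill` this describes all
points of the gate. -/
lemma eq_of_holds {v : ChartVar n N → R} (hv : ∀ s ∈ G.gateCons b, (G.con s).Holds v) :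
    v (.y b) = fold (G.label b).isMul (G.pred b) (fun a => v (.y a)) ∧
      ∀ i ∈ G.gateVars b, v i = G.gateFill b (fun a => v (.y a)) i := by
  have hw (a) : v (.w a) = G.gateInput b (fun a => v (.y a)) a := by
    by_cases ha : a ∈ G.pred b
    · have := hv (.load a) ha
      simpa [con, gateInput, ha] using this
    · have := hv (.neutral _ a) ⟨rfl, ha⟩
      simpa [con, gateInput, ha, algebraMap_neutral] using this
  have hs : (fun i => v (.s (G.label b).isMul i)) =
      partialFold (G.label b).isMul (G.gateInput b fun a => v (.y a)) := by
    refine eq_partialFold _ _ ?_ fun a => ?_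
    · simpa [con, algebraMap_neutral] using hv (.init _) rfl
    · simpa [con, hw] using hv (.step _ a) rfl
  constructor
  · have h1 := hv (.result _ b) ⟨rfl, rfl⟩
    rw [con, PolyConstraint.holds_eq] at h1
    rw [h1, ← fold_gateInput, ← partialFold_last, ← hs]
  · intro i hi
    cases i with
    | w a => exact hw a
    | s o i =>
      obtain rfl : o = _ := hi
      exact congrFun hs i
    | y a => rfl
    | _ => exact hi.elim

end

/-- Finite limits exist, and the graph of a gate never has to be identified: only its functor of
points is used. -/
lemma exists_gateLimit (b : Fin N) : ∃ L p q, G.base.IsLimit (G.gateVars b) (G.gateCons b) L p q := by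
  have : Finite G.base.κ := inferInstanceAs (Finite (ChartCon n m N))
  exact G.base.exists_isLimit_of_finite _ _ (fun _ _ _ _ _ h => h)
    (finite_toVar_constraintDiagram G.con)

/-- The graph of a gate. -/
def gateObj (b : Fin N) : SchemeOver k := (G.exists_gateLimit b).choose

/-- The values of the variables of a gate on its graph. -/
def gateVal (b : Fin N) : ∀ i ∈ G.gateVars b, G.gateObj b ⟶ affSpace k 1 :=
  (G.exists_gateLimit b).choose_spec.choose

/-- The morphisms from the graph of a gate to the constraints that define it. -/
def gateProj (b : Fin N) : ∀ s ∈ G.gateCons b, G.gateObj b ⟶ G.base.obj s :=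
  (G.exists_gateLimit b).choose_spec.choose_spec.choose

lemma isLimit_gate (b : Fin N) :
    G.base.IsLimit (G.gateVars b) (G.gateCons b) (G.gateObj b) (G.gateVal b) (G.gateProj b) :=
  (G.exists_gateLimit b).choose_spec.choose_spec.choose_spec

/-- The diagram of the variables, the constraints, and the graphs of all gates. -/
abbrev withGates : VarDiagram (SchemeOver k) (affSpace k 1) (ChartVar n N) :=
  G.base.extend G.gateVars G.gateCons G.gateObj G.gateVal G.gateProj

theorem computes_withGates :
    ∃ c ≤ 3 * (4 * (n + 1) + 2 + 8 * N + m) + N,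
      G.withGates.toRel.Computes (BasicMorphism k) c := by
  obtain ⟨c, hc, h⟩ := G.computes_base
  refine ⟨_, ?_, VarDiagram.computes_extend h _ _ _ _ _ G.isLimit_gate⟩
  rw [Nat.card_fin]
  omega

/-- By `hI`, exactly the `y` variables of the gate are visible in `I`. The inputs and partial
results of the chain are thus quantified inside each gate separately, and different gates do not
conflict over them. -/
lemma sat_gate_iff (b : Fin N) {I : Set (ChartVar n N)}
    (hI : ∀ i ∈ G.gateVars b, i ∈ I ↔ ∃ a, i = .y a) {M : SchemeOver k} (v : ChartVar n N → Fn M) :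
    G.withGates.Sat I (.inr b) v ↔
      v (.y b) = fold (G.label b).isMul (G.pred b) (fun a => v (.y a)) := by
  have key (a) (ha : a ∈ G.pred b ∨ a = b) : .y a ∈ G.gateVars b ∧ .y a ∈ I :=
    ⟨ha, (hI _ ha).2 ⟨a, rfl⟩⟩
  constructor
  · rintro ⟨g, hg⟩
    change M ⟶ G.gateObj b at g
    obtain ⟨v', hv'⟩ := exists_eq_total fun i hi => coord (g ≫ G.gateVal b i hi)
    have h1 : ∀ s ∈ G.gateCons b, (G.con s).Holds v' := fun s hs =>
      (sat_constraintDiagram_iff G.con (G.target_mem_gateVars b hs) v').1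
        ((G.isLimit_gate b).sat g hv' hs)
    have h2 (a) (ha : a ∈ G.pred b ∨ a = b) : v' (.y a) = v (.y a) := by
      rw [← hv' _ (key a ha).1]
      exact hg _ (key a ha).2 _ ⟨(key a ha).1, rfl⟩
    rw [← h2 b (.inr rfl), (G.eq_of_holds b h1).1]
    exact fold_congr _ fun a ha => h2 a (.inl ha)
  · intro h
    obtain ⟨g, hg⟩ := (G.isLimit_gate b).exists_hom (v := G.gateFill b fun a => v (.y a))
      fun s hs => (sat_constraintDiagram_iff G.con (G.target_mem_gateVars b hs) _).2
        (G.holds_gateFill b h hs)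
    refine ⟨g, ?_⟩
    rintro i hi _ ⟨hi', rfl⟩
    obtain ⟨a, rfl⟩ := (hI i hi').1 hi
    exact hg _ hi'

lemma determined_gate (b : Fin N) {I : Set (ChartVar n N)}
    (hI : ∀ i ∈ G.gateVars b, i ∈ I ↔ ∃ a, i = .y a) : G.withGates.Determined I (.inr b) := by
  intro M g g' h
  change M ⟶ G.gateObj b at g g'
  have key (g : M ⟶ G.gateObj b) : ∃ v : ChartVar n N → Fn M,
      ∀ i hi, coord (g ≫ G.gateVal b i hi) = v i ∧ v i = G.gateFill b (fun a => v (.y a)) i := by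
    obtain ⟨v, hv⟩ := exists_eq_total fun i hi => coord (g ≫ G.gateVal b i hi)
    exact ⟨v, fun i hi => ⟨hv i hi, (G.eq_of_holds b fun s hs =>
      (sat_constraintDiagram_iff G.con (G.target_mem_gateVars b hs) v).1
        ((G.isLimit_gate b).sat g hv hs)).2 i hi⟩⟩
  obtain ⟨v, hv⟩ := key g
  obtain ⟨v', hv'⟩ := key g'
  refine (G.isLimit_gate b).hom_ext
    (fun s hs => determined_constraintDiagram G.con (G.target_mem_gateVars b hs)) fun i hi => ?_
  rw [(hv i hi).1, (hv i hi).2, (hv' i hi).1, (hv' i hi).2]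
  refine G.gateFill_congr b (fun a ha => ?_) hi
  rw [← (hv (.y a) ha).1, ← (hv' (.y a) ha).1]
  exact h _ ((hI _ ha).2 ⟨a, rfl⟩) _ ⟨ha, rfl⟩

end GateSystem

end GateDiagram

/-! ## Gluing a projective scheme from its standard charts -/

section Atlas

variable {k : Type u} [Field k] {n m N : ℕ}

/-- A description of the scheme `X` defined by `f` in projective space by its standard charts, with
coordinate rings `A i` and coordinate functions `ξ i`, and their intersections, with coordinate
rings `B i j`. -/
structure ProjectiveAtlas (f : Fin m → MvPolynomial (Fin (n + 1)) k) (X : SchemeOver k) where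
  A : Fin (n + 1) → Type u
  [ringA : ∀ i, CommRing (A i)]
  [algebraA : ∀ i, Algebra k (A i)]
  ξ : ∀ i, Fin (n + 1) → A i
  ξ_self : ∀ i, ξ i i = 1
  aeval_ξ : ∀ i j, MvPolynomial.aeval (ξ i) (f j) = 0
  descA : ∀ (i) (R : Type u) [CommRing R] [Algebra k R] (x : Fin (n + 1) → R), x i = 1 →
    (∀ j, MvPolynomial.aeval x (f j) = 0) → ∃! φ : A i →ₐ[k] R, ∀ l, φ (ξ i l) = x l
  B : Fin (n + 1) → Fin (n + 1) → Type u
  [ringB : ∀ i j, CommRing (B i j)]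
  [algebraB : ∀ i j, Algebra k (B i j)]
  α : ∀ i j, A i →ₐ[k] B i j
  β : ∀ i j, A j →ₐ[k] B i j
  c : ∀ i j, B i j
  β_ξ : ∀ i j l, β i j (ξ j l) = c i j * α i j (ξ i l)
  descB : ∀ (i j) (R : Type u) [CommRing R] [Algebra k R] (a : A i →ₐ[k] R) (b : A j →ₐ[k] R)
    (d : R), (∀ l, b (ξ j l) = d * a (ξ i l)) →
      ∃! γ : B i j →ₐ[k] R, γ.comp (α i j) = a ∧ γ.comp (β i j) = b ∧ γ (c i j) = d
  r : ∀ i, specOver (A i) ⟶ X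
  glue : ∀ i j, specOverMap (α i j) ≫ r i = specOverMap (β i j) ≫ r j
  univ : ∀ (M : SchemeOver k) (b : ∀ i, specOver (A i) ⟶ M),
    (∀ i j, specOverMap (α i j) ≫ b i = specOverMap (β i j) ≫ b j) →
      ∃! h : X ⟶ M, ∀ i, r i ≫ h = b i

attribute [instance] ProjectiveAtlas.ringA ProjectiveAtlas.algebraA ProjectiveAtlas.ringB
  ProjectiveAtlas.algebraB

/-- Elements of an algebra as functions on its spectrum. -/
def toFn (A : Type u) [CommRing A] [Algebra k A] : A →ₐ[k] Fn (specOver (k := k) A) :=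
  pullFn (𝟙 (specOver A))

lemma map_toFn {A : Type u} [CommRing A] [Algebra k A] {M : SchemeOver k} (h : M ⟶ specOver A)
    (a : A) : Fn.map h (toFn A a) = pullFn h a := by
  have := congr($(pullFn_comp h (𝟙 (specOver A))) a)
  rw [Category.comp_id] at this
  exact this.symm

lemma pullFn_specOverMap_eq {A A' : Type u} [CommRing A] [Algebra k A] [CommRing A'] [Algebra k A']
    (α : A →ₐ[k] A') : pullFn (specOverMap α) = (toFn A').comp α := by
  rw [← Category.id_comp (specOverMap α), pullFn_specOverMap, toFn]

lemma specOverMap_comp_of_comp_eq_id {A A' : Type u} [CommRing A] [Algebra k A] [CommRing A']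
    [Algebra k A'] {α : A →ₐ[k] A'} {γ : A' →ₐ[k] A} (h : γ.comp α = AlgHom.id k A) :
    specOverMap γ ≫ specOverMap α = 𝟙 (specOver (k := k) A) := by
  refine pullFn_injective ?_
  rw [pullFn_specOverMap, pullFn_specOverMap_eq, AlgHom.comp_assoc, h, AlgHom.comp_id, toFn]

namespace ProjectiveAtlas

variable {G : GateSystem k (Fin (n + 1)) m N}
  {X : SchemeOver k} (Q : ProjectiveAtlas (fun j => G.value (G.out j)) X)

/-! ### Charts as limits -/

/-- The variables on a chart. -/
def chartVars (N : ℕ) (o : Bool) : Set (ChartVar n N) :=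
  {i | match i with
    | .z _ => True
    | .y _ => True
    | .x o' _ => o' = o
    | _ => False}

variable (G) in
/-- The constraints that define a chart. -/
def chartCons (o : Bool) (i : Fin (n + 1)) : Set (ChartCon n m N ⊕ Fin N) :=
  {s | match s with
    | .inl (.leaf b) => (G.label b).IsLeaf
    | .inl (.out _) => True
    | .inl (.one l) => l = i
    | .inl (.copy o' _) => o' = o
    | .inr b => ¬ (G.label b).IsLeaf
    | _ => False}

lemma mem_chartVars_iff (o : Bool) (b : Fin N) (i) (hi : i ∈ G.gateVars b) :
    i ∈ chartVars N o ↔ ∃ a, i = .y a := by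
  cases i with
  | y a => exact ⟨fun _ => ⟨a, rfl⟩, fun _ => trivial⟩
  | w a => exact ⟨fun h => h.elim, fun ⟨_, h⟩ => by cases h⟩
  | s o' j => exact ⟨fun h => h.elim, fun ⟨_, h⟩ => by cases h⟩
  | _ => exact hi.elim

lemma target_mem_chartVars (o : Bool) (i : Fin (n + 1)) {s : ChartCon n m N}
    (hs : .inl s ∈ chartCons G o i) (p) : (G.con s).target p ∈ chartVars N o := by
  cases s with
  | leaf b =>
    obtain ⟨a, h⟩ | ⟨a, h⟩ := (G.label b).target_con b p
    · exact h ▸ (trivial : ChartVar.y a ∈ chartVars N o)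
    · exact h ▸ (trivial : ChartVar.z a ∈ chartVars N o)
  | out j =>
    change Fin 1 at p
    fin_cases p; trivial
  | one l =>
    change Fin 1 at p
    fin_cases p; trivial
  | copy o' l =>
    change Fin 2 at p
    fin_cases p
    exacts [hs, trivial]
  | _ => exact hs.elim

lemma sat_chart_iff (o : Bool) (i : Fin (n + 1)) {M : SchemeOver k} (v : ChartVar n N → Fn M) :
    (∀ s ∈ chartCons G o i, G.withGates.Sat (chartVars N o) s v) ↔
      v (.z i) = 1 ∧ (∀ j, v (.y (G.out j)) = 0) ∧ (∀ l, v (.x o l) = v (.z l)) ∧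
        ∀ b, v (.y b) = MvPolynomial.aeval (fun l => v (.z l)) (G.value b) := by
  have hinl (s) (hs : .inl s ∈ chartCons G o i) :
      G.withGates.Sat (chartVars N o) (.inl s) v ↔ (G.con s).Holds v :=
    sat_constraintDiagram_iff G.con (target_mem_chartVars o i hs) v
  have hinr (b) := G.sat_gate_iff b (mem_chartVars_iff o b) v
  rw [← G.holds_iff (fun l => v (.z l)) fun a => v (.y a)]
  have hone : Sum.inl (.one i) ∈ chartCons G o i := rfl
  constructor
  · intro h
    refine ⟨?_, fun j => ?_, fun l => ?_, fun b => ?_⟩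
    · simpa [GateSystem.con] using (hinl _ hone).1 (h _ hone)
    · have hj : Sum.inl (.out j) ∈ chartCons G o i := trivial
      simpa [GateSystem.con] using (hinl _ hj).1 (h _ hj)
    · have hl : Sum.inl (.copy o l) ∈ chartCons G o i := rfl
      simpa [GateSystem.con] using (hinl _ hl).1 (h _ hl)
    · by_cases hb : (G.label b).IsLeaf
      · have hb' : Sum.inl (.leaf b) ∈ chartCons G o i := hb
        exact (CircuitLabel.holds_con_iff hb v _).1 ((hinl _ hb').1 (h _ hb'))
      · exact (CircuitLabel.holds_iff_of_not_isLeaf hb _ _ _ _).2 ((hinr b).1 (h (.inr b) hb))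
  · rintro ⟨h1, h2, h3, h4⟩ (s | b) hs
    · refine (hinl s hs).2 ?_
      cases s with
      | leaf b => exact (CircuitLabel.holds_con_iff hs v _).2 (h4 b)
      | out j => simpa [GateSystem.con] using h2 j
      | one l =>
        obtain rfl : l = i := hs
        simpa [GateSystem.con] using h1
      | copy o' l =>
        obtain rfl : o' = o := hs
        simpa [GateSystem.con] using h3 l
      | _ => exact hs.elim
    · exact (hinr b).2 ((CircuitLabel.holds_iff_of_not_isLeaf hs _ _ _ _).1 (h4 b))

/-- The values of the variables on a chart. -/
def chartFill (i : Fin (n + 1)) : ChartVar n N → Fn (specOver (k := k) (Q.A i))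
  | .z l => toFn _ (Q.ξ i l)
  | .x _ l => toFn _ (Q.ξ i l)
  | .y a => toFn _ (MvPolynomial.aeval (Q.ξ i) (G.value a))
  | _ => 0

lemma exists_chartLimit (t : Bool × Fin (n + 1)) : ∃ q, G.withGates.IsLimit (chartVars N t.1)
    (chartCons G t.1 t.2) (specOver (Q.A t.2)) (fun i _ => ofCoord (Q.chartFill t.2 i)) q := by
  obtain ⟨o, i⟩ := t
  refine G.withGates.exists_isLimit_of_values _ _ _ _ ?_ ?_ ?_ ?_
  · rintro (s | b) hs (s' | b') hs' e he
    · exact he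
    · exact he
    -- A gate has edges only to the constraints that define it, and none of these occurs among the
    -- constraints of a chart.
    · obtain ⟨h, -⟩ := he
      cases s' <;> first | exact h | exact hs'
    · exact he
  · rintro (s | b) hs
    · exact determined_constraintDiagram G.con (target_mem_chartVars o i hs)
    · exact G.determined_gate b (mem_chartVars_iff o b)
  · refine (sat_chart_iff o i _).2 ⟨?_, fun j => ?_, fun l => rfl, fun b => ?_⟩
    · simp [chartFill, Q.ξ_self]
    · simp [chartFill, Q.aeval_ξ]
    · exact MvPolynomial.comp_aeval_apply _ _ _
  · intro M a ha
    obtain ⟨h1, h2, h3, h4⟩ := (sat_chart_iff o i a).1 ha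
    -- An assignment satisfying the chart is determined by its `z` part, a point with i-th
    -- coordinate 1 at which all equations vanish; `descA` represents these points.
    obtain ⟨φ, hφ, hu⟩ := Q.descA i (Fn M) (fun l => a (.z l)) h1 fun j => by rw [← h4, h2]
    refine ⟨liftFn φ, fun s hs => ?_, fun h hh => ?_⟩
    · cases s with
      | z l => rw [chartFill, map_toFn, pullFn_liftFn, hφ]
      | x o' l =>
        obtain rfl : o' = o := hs
        rw [chartFill, map_toFn, pullFn_liftFn, hφ, h3]
      | y b =>
        rw [chartFill, map_toFn, pullFn_liftFn, h4, MvPolynomial.comp_aeval_apply]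
        congr 2
        exact funext hφ
      | _ => exact hs.elim
    · rw [← hu (pullFn h) fun l => ?_, liftFn_pullFn]
      rw [← map_toFn]
      exact hh (.z l) trivial

/-- The diagram of the variables, the constraints, the gates, and two copies of each chart. -/
abbrev withCharts : VarDiagram (SchemeOver k) (affSpace k 1) (ChartVar n N) :=
  G.withGates.extend (T := Bool × Fin (n + 1)) (fun t => chartVars N t.1)
    (fun t => chartCons G t.1 t.2) (fun t => specOver (Q.A t.2))
    (fun t i _ => ofCoord (Q.chartFill t.2 i)) (fun t => (Q.exists_chartLimit t).choose)

theorem computes_withCharts :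
    ∃ c ≤ 3 * (4 * (n + 1) + 2 + 8 * N + m) + N + 2 * (n + 1),
      Q.withCharts.toRel.Computes (BasicMorphism k) c := by
  obtain ⟨c, hc, h⟩ := G.computes_withGates
  refine ⟨_, ?_, VarDiagram.computes_extend h _ _ _ _ _
    fun t => (Q.exists_chartLimit t).choose_spec⟩
  rw [Nat.card_prod, Nat.card_fin, Nat.card_eq_fintype_card, Fintype.card_bool]
  omega

/-! ### Overlaps of charts as limits -/

/-- The variables on the intersection of two charts. -/
def overlapVars (n N : ℕ) : Set (ChartVar n N) :=
  {i | match i with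
    | .scalar => True
    | .x _ _ => True
    | _ => False}

/-- The constraints that define the intersection of two charts. -/
def overlapCons (n m N : ℕ) (t : Fin (n + 1) × Fin (n + 1)) :
    Set ((ChartCon n m N ⊕ Fin N) ⊕ Bool × Fin (n + 1)) :=
  {s | match s with
    | .inl (.inl (.scale _)) => True
    | .inr (false, i) => i = t.1
    | .inr (true, j) => j = t.2
    | _ => False}

lemma coord_chart {i : Fin (n + 1)} {M : SchemeOver k} (g : M ⟶ specOver (Q.A i)) (o : Bool)
    (l : Fin (n + 1)) :
    coord (g ≫ ofCoord (Q.chartFill i (.x o l))) = pullFn g (Q.ξ i l) := by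
  rw [coord_comp_ofCoord, chartFill, map_toFn]

/-- Of the variables of a chart, an overlap contains only the copy `x o`. The shared `z` and `y` are
hidden, so the charts with `o = false` and `o = true` can be at different points. -/
lemma sat_chart_overlap_iff (o : Bool) (i : Fin (n + 1)) {M : SchemeOver k}
    (v : ChartVar n N → Fn M) : Q.withCharts.Sat (overlapVars n N) (.inr (o, i)) v ↔
      ∃ φ : Q.A i →ₐ[k] Fn M, ∀ l, φ (Q.ξ i l) = v (.x o l) := by
  constructor
  · rintro ⟨g, hg⟩
    change M ⟶ specOver (Q.A i) at g
    exact ⟨pullFn g, fun l => (Q.coord_chart g o l).symm.trans (hg (.x o l) trivial _ ⟨rfl, rfl⟩)⟩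
  · rintro ⟨φ, hφ⟩
    refine ⟨liftFn φ, ?_⟩
    rintro s hs _ ⟨hs', rfl⟩
    cases s with
    | x o' l =>
      obtain rfl : o' = o := hs'
      exact (Q.coord_chart _ o' l).trans (by rw [pullFn_liftFn, hφ])
    | scalar => exact hs'.elim
    | _ => exact hs.elim

/-- The uniqueness part of `descA`, applied to the images of the coordinates under `ψ`, which
satisfy the equations automatically. -/
lemma hom_ext_chart {i : Fin (n + 1)} {R : Type u} [CommRing R] [Algebra k R]
    {φ ψ : Q.A i →ₐ[k] R} (h : ∀ l, φ (Q.ξ i l) = ψ (Q.ξ i l)) : φ = ψ := by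
  refine (Q.descA i R (fun l => ψ (Q.ξ i l)) (by rw [Q.ξ_self, map_one]) fun j => ?_).unique h
    fun l => rfl
  rw [← MvPolynomial.comp_aeval_apply, Q.aeval_ξ, map_zero]

lemma determined_chart (o : Bool) (i : Fin (n + 1)) :
    Q.withCharts.Determined (overlapVars n N) (.inr (o, i)) := by
  intro M g g' h
  change M ⟶ specOver (Q.A i) at g g'
  refine pullFn_injective (Q.hom_ext_chart fun l => ?_)
  rw [← Q.coord_chart g o l, ← Q.coord_chart g' o l]
  exact h (.x o l) trivial _ ⟨rfl, rfl⟩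

/-- The values of the variables on the intersection of two charts. -/
def overlapFill (t : Fin (n + 1) × Fin (n + 1)) :
    ChartVar n N → Fn (specOver (k := k) (Q.B t.1 t.2))
  | .scalar => toFn _ (Q.c t.1 t.2)
  | .x false l => toFn _ (Q.α t.1 t.2 (Q.ξ t.1 l))
  | .x true l => toFn _ (Q.β t.1 t.2 (Q.ξ t.2 l))
  | _ => 0

lemma target_mem_overlapVars (l : Fin (n + 1)) (p) :
    (G.con (.scale l)).target p ∈ overlapVars n N := by
  change Fin 3 at p
  fin_cases p <;> trivial

lemma sat_overlap_iff (t : Fin (n + 1) × Fin (n + 1)) {M : SchemeOver k} (v : ChartVar n N → Fn M) :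
    (∀ s ∈ overlapCons n m N t, Q.withCharts.Sat (overlapVars n N) s v) ↔
      (∀ l, v (.x true l) = v .scalar * v (.x false l)) ∧
      (∃ φ : Q.A t.1 →ₐ[k] Fn M, ∀ l, φ (Q.ξ t.1 l) = v (.x false l)) ∧
      ∃ φ : Q.A t.2 →ₐ[k] Fn M, ∀ l, φ (Q.ξ t.2 l) = v (.x true l) := by
  have hs (l) : Q.withCharts.Sat (overlapVars n N) (.inl (.inl (.scale l))) v ↔
      v (.x true l) = v .scalar * v (.x false l) :=
    (sat_constraintDiagram_iff G.con (target_mem_overlapVars l) v).trans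
      (by simp [GateSystem.con])
  constructor
  · intro h
    exact ⟨fun l => (hs l).1 (h (.inl (.inl (.scale l))) trivial),
      (Q.sat_chart_overlap_iff _ _ v).1 (h (.inr (false, t.1)) rfl),
      (Q.sat_chart_overlap_iff _ _ v).1 (h (.inr (true, t.2)) rfl)⟩
  · rintro ⟨h1, h2, h3⟩ ((s | b) | ⟨o, i⟩) hs'
    · cases s with
      | scale l => exact (hs l).2 (h1 l)
      | _ => exact hs'.elim
    · exact hs'.elim
    · cases o
      · obtain rfl : i = t.1 := hs'
        exact (Q.sat_chart_overlap_iff _ _ v).2 h2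
      · obtain rfl : i = t.2 := hs'
        exact (Q.sat_chart_overlap_iff _ _ v).2 h3

lemma exists_overlapLimit (t : Fin (n + 1) × Fin (n + 1)) : ∃ q, Q.withCharts.IsLimit
    (overlapVars n N) (overlapCons n m N t) (specOver (Q.B t.1 t.2))
      (fun i _ => ofCoord (Q.overlapFill t i)) q := by
  refine Q.withCharts.exists_isLimit_of_values _ _ _ _ ?_ ?_ ?_ ?_
  · rintro ((s | b) | ⟨o, i⟩) hs ((s' | b') | ⟨o', i'⟩) hs' e he
    · exact he
    · exact he
    · exact he
    · exact hs
    · exact hs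
    · exact he
    -- A chart has no edge to a `scale` constraint, and these are the only base constraints in an
    -- overlap.
    · obtain ⟨h, -⟩ := he
      cases s' <;> first | exact h | exact hs'
    · exact hs'
    · exact he
  · rintro ((s | b) | ⟨o, i⟩) hs
    · cases s with
      | scale l => exact determined_constraintDiagram G.con (target_mem_overlapVars l)
      | _ => exact hs.elim
    · exact hs.elim
    · exact Q.determined_chart o i
  · refine (Q.sat_overlap_iff t _).2 ⟨fun l => ?_, ⟨(toFn _).comp (Q.α t.1 t.2), fun l => rfl⟩,
      (toFn _).comp (Q.β t.1 t.2), fun l => rfl⟩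
    simp [overlapFill, Q.β_ξ]
  · intro M a ha
    obtain ⟨h1, ⟨φ, hφ⟩, ψ, hψ⟩ := (Q.sat_overlap_iff t a).1 ha
    obtain ⟨γ, ⟨hα, hβ, hc⟩, hu⟩ := Q.descB t.1 t.2 (Fn M) φ ψ (a .scalar)
      fun l => by rw [hψ, h1, hφ]
    refine ⟨liftFn γ, fun s hs => ?_, fun h hh => ?_⟩
    · match s, hs with
      | .scalar, _ => rw [overlapFill, map_toFn, pullFn_liftFn, hc]
      | .x false l, _ =>
        rw [overlapFill, map_toFn, pullFn_liftFn, ← hφ, ← hα, AlgHom.comp_apply]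
      | .x true l, _ =>
        rw [overlapFill, map_toFn, pullFn_liftFn, ← hψ, ← hβ, AlgHom.comp_apply]
    · rw [← hu (pullFn h) ⟨?_, ?_, ?_⟩, liftFn_pullFn]
      · refine Q.hom_ext_chart fun l => ?_
        rw [AlgHom.comp_apply, ← map_toFn, hφ]
        exact hh (.x false l) trivial
      · refine Q.hom_ext_chart fun l => ?_
        rw [AlgHom.comp_apply, ← map_toFn, hψ]
        exact hh (.x true l) trivial
      · rw [← map_toFn]
        exact hh .scalar trivial

/-- The morphisms from the intersection of two charts. -/
def overlapProj (t : Fin (n + 1) × Fin (n + 1)) :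
    ∀ s ∈ overlapCons n m N t, specOver (Q.B t.1 t.2) ⟶ Q.withCharts.obj s :=
  (Q.exists_overlapLimit t).choose

lemma isLimit_overlap (t : Fin (n + 1) × Fin (n + 1)) : Q.withCharts.IsLimit
    (overlapVars n N) (overlapCons n m N t) (specOver (Q.B t.1 t.2))
      (fun i _ => ofCoord (Q.overlapFill t i)) (Q.overlapProj t) :=
  (Q.exists_overlapLimit t).choose_spec

/-- The legs of the limit were only known to exist; the cone condition gives their coordinates, and
these determine a morphism to a chart. -/
lemma overlapProj_left (t : Fin (n + 1) × Fin (n + 1)) (h) :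
    Q.overlapProj t (.inr (false, t.1)) h = specOverMap (Q.α t.1 t.2) := by
  refine pullFn_injective (A := Q.A t.1) (Q.hom_ext_chart fun l => ?_)
  refine (Q.coord_chart (i := t.1) (Q.overlapProj t _ h) false l).symm.trans ?_
  rw [pullFn_specOverMap_eq]
  exact (congrArg coord ((Q.isLimit_overlap t).cone _ h (.x false l) trivial _ ⟨rfl, rfl⟩)).trans
    (coord_ofCoord _)

lemma overlapProj_right (t : Fin (n + 1) × Fin (n + 1)) (h) :
    Q.overlapProj t (.inr (true, t.2)) h = specOverMap (Q.β t.1 t.2) := by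
  refine pullFn_injective (A := Q.A t.2) (Q.hom_ext_chart fun l => ?_)
  refine (Q.coord_chart (i := t.2) (Q.overlapProj t _ h) true l).symm.trans ?_
  rw [pullFn_specOverMap_eq]
  exact (congrArg coord ((Q.isLimit_overlap t).cone _ h (.x true l) trivial _ ⟨rfl, rfl⟩)).trans
    (coord_ofCoord _)

/-- The diagram of all objects from which `X` is glued. -/
abbrev withOverlaps : VarDiagram (SchemeOver k) (affSpace k 1) (ChartVar n N) :=
  Q.withCharts.extend (T := Fin (n + 1) × Fin (n + 1)) (fun _ => overlapVars n N)
    (overlapCons n m N) (fun t => specOver (Q.B t.1 t.2))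
    (fun t i _ => ofCoord (Q.overlapFill t i)) Q.overlapProj

theorem computes_withOverlaps :
    ∃ c ≤ 3 * (4 * (n + 1) + 2 + 8 * N + m) + N + 2 * (n + 1) + (n + 1) * (n + 1),
      Q.withOverlaps.toRel.Computes (BasicMorphism k) c := by
  obtain ⟨c, hc, h⟩ := Q.computes_withCharts
  refine ⟨_, ?_, VarDiagram.computes_extend h _ _ _ _ _ Q.isLimit_overlap⟩
  rw [Nat.card_prod, Nat.card_fin]
  omega

/-! ### The final colimit -/

/-- The two copies of a chart are identified on their intersection. -/
lemma eq_of_compat (i : Fin (n + 1)) {M : SchemeOver k} {g g' : specOver (Q.A i) ⟶ M}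
    (h : specOverMap (Q.α i i) ≫ g = specOverMap (Q.β i i) ≫ g') : g = g' := by
  -- The diagonal: two equal points of chart i with scalar 1. It is a common section of both
  -- projections from the overlap of the chart with itself.
  obtain ⟨γ, ⟨hα, hβ, -⟩, -⟩ := Q.descB i i (Q.A i) (AlgHom.id k _) (AlgHom.id k _) 1
    fun l => (one_mul _).symm
  rw [← Category.id_comp g, ← Category.id_comp g', ← specOverMap_comp_of_comp_eq_id hα,
    Category.assoc, h, ← Category.assoc, specOverMap_comp_of_comp_eq_id hα,
    specOverMap_comp_of_comp_eq_id hβ]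

/-- The charts and their intersections. -/
def pieces (n m N : ℕ) :
    Set (((ChartCon n m N ⊕ Fin N) ⊕ Bool × Fin (n + 1)) ⊕ Fin (n + 1) × Fin (n + 1)) :=
  {s | match s with
    | .inl (.inl _) => False
    | _ => True}

include Q in
theorem mixedComplexity_le : mixedComplexity (BasicMorphism k) X ≤
    ((3 * (4 * (n + 1) + 2 + 8 * N + m) + N + 2 * (n + 1) + (n + 1) * (n + 1) + 1 : ℕ) : ℕ∞) := by
  obtain ⟨c, hc, h⟩ := Q.computes_withOverlaps
  refine le_trans ?_ (Nat.cast_le.2 (Nat.add_le_add_right hc 1))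
  refine VarDiagram.mixedComplexity_le h (pieces n m N) X (fun s hs => match s, hs with
    | .inl (.inr t), _ => Q.r t.2
    | .inr t, _ => specOverMap (Q.α t.1 t.2) ≫ Q.r t.1) ?_ ?_
  · rintro ((s | ⟨o, i⟩) | t) hs ((s' | ⟨o', i'⟩) | t') hs' e he
    all_goals first | exact hs.elim | exact hs'.elim | exact he.elim | skip
    obtain ⟨h, rfl⟩ := he
    cases o'
    · obtain rfl : i' = t.1 := h
      exact congrArg (· ≫ Q.r t.1) (Q.overlapProj_left t rfl)
    · obtain rfl : i' = t.2 := h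
      exact (congrArg (· ≫ Q.r t.2) (Q.overlapProj_right t rfl)).trans (Q.glue t.1 t.2).symm
  · intro M b hb
    have hb1 (t : Fin (n + 1) × Fin (n + 1)) :
        specOverMap (Q.α t.1 t.2) ≫ b (.inl (.inr (false, t.1))) trivial = b (.inr t) trivial := by
      rw [← hb (.inr t) trivial (.inl (.inr (false, t.1))) trivial _ ⟨rfl, rfl⟩]
      exact (congrArg (· ≫ b (.inl (.inr (false, t.1))) trivial) (Q.overlapProj_left t rfl)).symm
    have hb2 (t : Fin (n + 1) × Fin (n + 1)) :
        specOverMap (Q.β t.1 t.2) ≫ b (.inl (.inr (true, t.2))) trivial = b (.inr t) trivial := by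
      rw [← hb (.inr t) trivial (.inl (.inr (true, t.2))) trivial _ ⟨rfl, rfl⟩]
      exact (congrArg (· ≫ b (.inl (.inr (true, t.2))) trivial) (Q.overlapProj_right t rfl)).symm
    -- The overlap (i, i) forces any cocone to agree on the two copies of chart i, so the doubled
    -- charts have the same colimit as the original gluing data.
    have hb3 (i : Fin (n + 1)) :
        b (.inl (.inr (true, i))) trivial = b (.inl (.inr (false, i))) trivial :=
      (Q.eq_of_compat i ((hb1 (i, i)).trans (hb2 (i, i)).symm)).symm
    obtain ⟨g, hg, hu⟩ := Q.univ M (fun i => b (.inl (.inr (false, i))) trivial) fun i j =>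
      (hb1 (i, j)).trans ((hb2 (i, j)).symm.trans (congrArg _ (hb3 j)))
    refine ⟨g, ?_, fun g' hg' => hu g' fun i => hg' (.inl (.inr (false, i))) trivial⟩
    rintro ((s | ⟨o, i⟩) | t) hs
    · exact hs.elim
    · cases o
      · exact hg i
      · exact (hg i).trans (hb3 i).symm
    · exact (Category.assoc _ _ _).trans ((congrArg _ (hg t.1)).trans (hb1 t))

end ProjectiveAtlas

end Atlas

attribute [local instance] MvPolynomial.gradedAlgebra

/-! ## The standard charts of a projective scheme -/

section Charts

open HomogeneousLocalization

variable {k : Type u} [Field k] {S : Type u} [CommRing S] [Algebra k S]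
  {𝒮 : ℕ → Submodule k S} [GradedAlgebra 𝒮]

instance (x : Submonoid S) : Algebra k (HomogeneousLocalization 𝒮 x) where
  algebraMap := (fromZeroRingHom 𝒮 x).comp (algebraMap k (𝒮 0))
  commutes' _ _ := mul_comm _ _
  smul_def' c a := by
    refine HomogeneousLocalization.val_injective x ?_
    rw [val_smul, val_mul, Algebra.smul_def]
    rfl

/-- The inclusion of the part of degree `0` of a localization. -/
def valHom (𝒮 : ℕ → Submodule k S) [GradedAlgebra 𝒮] (x : Submonoid S) :
    HomogeneousLocalization 𝒮 x →ₐ[k] Localization x where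
  toRingHom := algebraMap _ _
  commutes' _ := rfl

lemma MvPolynomial.IsHomogeneous.aeval_mul {σ : Type*} {R : Type*} [CommRing R] [Algebra k R]
    {p : MvPolynomial σ k} {d : ℕ} (hp : p.IsHomogeneous d) (t : R) (x : σ → R) :
    MvPolynomial.aeval (fun l => t * x l) p = t ^ d * MvPolynomial.aeval x p := by
  rw [MvPolynomial.aeval_def, MvPolynomial.aeval_def, MvPolynomial.eval₂_eq,
    MvPolynomial.eval₂_eq, Finset.mul_sum]
  refine Finset.sum_congr rfl fun e he => ?_
  rw [hp.degree_eq_sum_deg_support he, ← Finset.prod_pow_eq_pow_sum]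
  simp_rw [mul_pow]
  rw [Finset.prod_mul_distrib, mul_left_comm]

variable {σ : Type*} {s : σ → S} (hs : ∀ l, s l ∈ 𝒮 1)

/-- The coordinate function `s l / s i` on the chart of `s i`. -/
def awayCoord (i l : σ) : Away 𝒮 (s i) :=
  Away.mk 𝒮 (hs i) 1 (s l) (by simpa using hs l)

lemma awayCoord_self (i : σ) : awayCoord hs i i = 1 := by
  ext
  rw [awayCoord, Away.val_mk, val_one]
  simp only [pow_one]
  exact Localization.mk_self (⟨s i, _⟩ : Submonoid.powers (s i))

/-- Homogeneity: p(s/sᵢ) = p(s)/sᵢᵈ, checked in the full localization. -/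
lemma aeval_awayCoord (i : σ) {p : MvPolynomial σ k} {d : ℕ} (hp : p.IsHomogeneous d)
    (h : MvPolynomial.aeval s p ∈ 𝒮 (d • 1)) :
    MvPolynomial.aeval (awayCoord hs i) p =
      Away.mk 𝒮 (hs i) d (MvPolynomial.aeval s p) h := by
  refine HomogeneousLocalization.val_injective _ ?_
  change valHom 𝒮 _ _ = _
  rw [MvPolynomial.comp_aeval_apply, Away.val_mk]
  have h1 : (fun l => valHom 𝒮 _ (awayCoord hs i l)) = fun l =>
      Localization.mk 1 (⟨s i, Submonoid.mem_powers _⟩ : Submonoid.powers (s i)) *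
        algebraMap S (Localization.Away (s i)) (s l) := by
    funext l
    change Localization.mk _ _ = _
    rw [← Localization.mk_one_eq_algebraMap, Localization.mk_mul]
    simp
  have h2 : MvPolynomial.aeval (fun l => algebraMap S (Localization.Away (s i)) (s l)) p = _ :=
    MvPolynomial.aeval_algebraMap_apply (Localization.Away (s i)) s p
  rw [h1, hp.aeval_mul, Localization.mk_pow, h2,
    ← Localization.mk_one_eq_algebraMap, Localization.mk_mul, one_pow, one_mul, mul_one]
  rfl

/-- The homomorphism from the chart of `t` given by a homomorphism that maps `t` to `1`. -/
def awayDesc {R : Type*} [CommRing R] [Algebra k R] (g : S →ₐ[k] R) (t : S) (h : g t = 1) :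
    Away 𝒮 t →ₐ[k] R :=
  (IsLocalization.liftAlgHom (M := Submonoid.powers t) (S := Localization.Away t) (f := g) (by
    rintro ⟨_, n, rfl⟩
    rw [map_pow, h, one_pow]
    exact isUnit_one)).comp (valHom 𝒮 _)

lemma awayDesc_awayCoord {R : Type*} [CommRing R] [Algebra k R] (g : S →ₐ[k] R) (i : σ)
    (h : g (s i) = 1) (l : σ) : awayDesc g (s i) h (awayCoord hs i l) = g (s l) := by
  change IsLocalization.lift _ (Localization.mk _ _) = _
  rw [Localization.mk_eq_mk', IsLocalization.lift_mk'_spec]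
  simp [h]

variable (hgen : ∀ d, ∀ a ∈ 𝒮 d, ∃ p : MvPolynomial σ k, p.IsHomogeneous d ∧
  MvPolynomial.aeval s p = a)

include hgen in
lemma exists_aeval_awayCoord (i : σ) (z : Away 𝒮 (s i)) :
    ∃ p : MvPolynomial σ k, MvPolynomial.aeval (awayCoord hs i) p = z := by
  obtain ⟨d, a, ha, rfl⟩ := Away.mk_surjective 𝒮 (hs i) z
  obtain ⟨p, hp, rfl⟩ := hgen _ a ha
  rw [smul_eq_mul, mul_one] at hp
  exact ⟨p, aeval_awayCoord hs i hp ha⟩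

include hgen in
lemma away_hom_ext (i : σ) {R : Type*} [CommRing R] [Algebra k R] {φ ψ : Away 𝒮 (s i) →ₐ[k] R}
    (h : ∀ l, φ (awayCoord hs i l) = ψ (awayCoord hs i l)) : φ = ψ := by
  refine AlgHom.ext fun z => ?_
  obtain ⟨p, rfl⟩ := exists_aeval_awayCoord hs hgen i z
  rw [MvPolynomial.comp_aeval_apply, MvPolynomial.comp_aeval_apply]
  congr 2
  exact funext h

/-- The restriction to the intersection with another chart. -/
def awayRestrict {t t' x : S} {d : ℕ} (ht' : t' ∈ 𝒮 d) (hx : x = t * t') :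
    Away 𝒮 t →ₐ[k] Away 𝒮 x where
  toRingHom := awayMap 𝒮 ht' hx
  commutes' _ := awayMap_fromZeroRingHom ..

/-- The function `s i / s j` on the intersection of the charts of `s i` and `s j`. -/
def awayRatio (i j : σ) : Away 𝒮 (s i * s j) :=
  Away.mk 𝒮 (SetLike.mul_mem_graded (hs i) (hs j)) 1 (s i * s i)
    (by simpa using SetLike.mul_mem_graded (hs i) (hs i))

/-- This is sₗ/sⱼ = (sᵢ/sⱼ)(sₗ/sᵢ): the scalar on an overlap is the change of chart. -/
lemma awayRestrict_awayCoord (i j l : σ) :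
    awayRestrict (hs i) (mul_comm (s i) (s j)) (awayCoord hs j l) =
      awayRatio hs i j * awayRestrict (hs j) rfl (awayCoord hs i l) := by
  change awayMap 𝒮 (hs i) (mul_comm (s i) (s j)) _ =
    awayRatio hs i j * awayMap 𝒮 (hs j) rfl _
  ext
  rw [awayCoord, awayCoord, awayMap_mk, awayMap_mk, awayRatio, val_mul, Away.val_mk, Away.val_mk,
    Away.val_mk, Localization.mk_mul, Localization.mk_eq_mk_iff, Localization.r_iff_exists]
  refine ⟨1, ?_⟩
  simp
  ring

lemma isLocalization_awayRestrict (i j : σ) :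
    letI := (awayRestrict (hs j) (rfl : s i * s j = s i * s j)).toRingHom.toAlgebra
    IsLocalization.Away (awayCoord hs i j) (Away 𝒮 (s i * s j)) := by
  have := Away.isLocalization_mul (hs i) (hs j) rfl one_ne_zero
  have hij : Away.isLocalizationElem (hs i) (hs j) = awayCoord hs i j := by
    ext
    simp [awayCoord]
  rwa [hij] at this

lemma existsUnique_comp_eq {A B R : Type*} [CommRing A] [CommRing B] [CommRing R] [Algebra k A]
    [Algebra k B] [Algebra k R] (α : A →ₐ[k] B) (t : A)
    (hα : letI := α.toRingHom.toAlgebra; IsLocalization.Away t B) (a : A →ₐ[k] R)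
    (ht : IsUnit (a t)) : ∃! γ : B →ₐ[k] R, γ.comp α = a := by
  let := α.toRingHom.toAlgebra
  have : IsScalarTower k A B := IsScalarTower.of_algHom α
  have hu : ∀ y : Submonoid.powers t, IsUnit (a y) := by
    rintro ⟨_, n, rfl⟩
    rw [map_pow]
    exact ht.pow n
  have hγ : (IsLocalization.liftAlgHom (S := B) hu).comp α = a :=
    AlgHom.ext fun z => IsLocalization.lift_eq _ z
  refine ⟨_, hγ, fun γ h => ?_⟩
  exact IsLocalization.algHom_ext (Submonoid.powers t) (h.trans hγ.symm)

-- The overlap is the localization of chart i at sⱼ/sᵢ. The relation makes `d` an inverse of the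
-- image of sⱼ/sᵢ, so `a` extends uniquely, and the extension recovers both `d` and `b`.
include hgen in
lemma existsUnique_awayDesc (i j : σ) {R : Type*} [CommRing R] [Algebra k R]
    (a : Away 𝒮 (s i) →ₐ[k] R) (b : Away 𝒮 (s j) →ₐ[k] R) (d : R)
    (h : ∀ l, b (awayCoord hs j l) = d * a (awayCoord hs i l)) :
    ∃! γ : Away 𝒮 (s i * s j) →ₐ[k] R,
      γ.comp (awayRestrict (hs j) rfl) = a ∧
        γ.comp (awayRestrict (hs i) (mul_comm (s i) (s j))) = b ∧ γ (awayRatio hs i j) = d := by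
  -- The case l = j of `h`, where the coordinate on chart j is 1.
  have hd : d * a (awayCoord hs i j) = 1 := by
    rw [← h, awayCoord_self, map_one]
  obtain ⟨γ, hγ, hunique⟩ := existsUnique_comp_eq (awayRestrict (hs j) rfl) (awayCoord hs i j)
    (isLocalization_awayRestrict hs i j) a (IsUnit.of_mul_eq_one _ ((mul_comm _ _).trans hd))
  -- Both sides are inverse to the image of sⱼ/sᵢ.
  have hratio : γ (awayRatio hs i j) = d := by
    have h1 := congrArg γ (awayRestrict_awayCoord hs i j j)
    rw [awayCoord_self, map_one, map_one, map_mul, ← AlgHom.comp_apply γ, hγ] at h1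
    rw [← mul_one (γ _), ← hd, mul_left_comm, ← h1, mul_one]
  refine ⟨γ, ⟨hγ, ?_, hratio⟩, fun γ' hγ' => hunique _ hγ'.1⟩
  refine away_hom_ext hs hgen j fun l => ?_
  rw [AlgHom.comp_apply, awayRestrict_awayCoord, map_mul, hratio, h, ← AlgHom.comp_apply, hγ]

section Glue

variable {ι : Type*} {s : ι → S} (hs : ∀ l, s l ∈ 𝒮 1)
  (hspan : (HomogeneousIdeal.irrelevant 𝒮).toIdeal ≤ Ideal.span (Set.range s))

include hspan in
/-- Morphisms from `Proj` can be glued from morphisms on the standard charts. -/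
lemma existsUnique_awayι_comp {M : Scheme.{u}}
    (b : ∀ i, Spec (CommRingCat.of (Away 𝒮 (s i))) ⟶ M)
    (hb : ∀ i j, Spec.map (CommRingCat.ofHom (awayMap 𝒮 (hs j) (rfl : s i * s j = _))) ≫ b i =
      Spec.map (CommRingCat.ofHom (awayMap 𝒮 (hs i) (mul_comm (s i) (s j)))) ≫ b j) :
    ∃! h : Proj 𝒮 ⟶ M, ∀ i, Proj.awayι 𝒮 (s i) (hs i) zero_lt_one ≫ h = b i := by
  -- `hspan` says that the standard charts cover Proj; their pairwise fibre products are the charts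
  -- of the products sᵢsⱼ, so `hb` is the gluing condition.
  let 𝒰 := (Proj.affineOpenCoverOfIrrelevantLESpan 𝒮 s hs (fun _ => zero_lt_one) hspan).openCover
  refine ⟨𝒰.glueMorphisms b fun i j => ?_, fun i => 𝒰.ι_glueMorphisms b _ i, fun h hh =>
    𝒰.hom_ext _ _ fun i => (hh i).trans (𝒰.ι_glueMorphisms b _ i).symm⟩
  have h := congrArg
    ((Proj.pullbackAwayιIso 𝒮 (hs i) zero_lt_one (hs j) zero_lt_one rfl).hom ≫ ·) (hb i j)
  simp only [← Category.assoc] at h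
  rw [Proj.pullbackAwayιIso_hom_SpecMap_awayMap_left] at h
  refine h.trans (congrArg (· ≫ b j) ?_)
  exact Proj.pullbackAwayιIso_hom_SpecMap_awayMap_right ..

end Glue

end Charts

/-! ### The atlas of a zero scheme -/

section ZeroScheme

open HomogeneousLocalization

variable {k : Type u} [Field k] {n m : ℕ} (f : Fin m → MvPolynomial (Fin (n + 1)) k)
  (hf : ∀ i, ∃ d, (f i).IsHomogeneous d)

/-- The grading of the homogeneous coordinate ring of a zero scheme. -/
abbrev zeroGrading : ℕ → Submodule k (_ ⧸ (zeroIdeal f hf).toIdeal) :=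
  quotientGrading (zeroIdeal f hf)

/-- The homogeneous coordinates on a zero scheme. -/
def zeroCoord (l : Fin (n + 1)) : MvPolynomial (Fin (n + 1)) k ⧸ (zeroIdeal f hf).toIdeal :=
  quotientGradedHom (zeroIdeal f hf) (MvPolynomial.X l)

lemma zeroCoord_mem (l : Fin (n + 1)) : zeroCoord f hf l ∈ zeroGrading f hf 1 :=
  (quotientGradedHom (zeroIdeal f hf)).2 (MvPolynomial.isHomogeneous_X k l)

lemma aeval_zeroCoord (p : MvPolynomial (Fin (n + 1)) k) :
    MvPolynomial.aeval (zeroCoord f hf) p = Ideal.Quotient.mk (zeroIdeal f hf).toIdeal p := by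
  change _ = Ideal.Quotient.mkₐ k _ p
  rw [MvPolynomial.aeval_unique (Ideal.Quotient.mkₐ k (zeroIdeal f hf).toIdeal)]
  rfl

lemma exists_aeval_zeroCoord (d : ℕ) (a) (ha : a ∈ zeroGrading f hf d) :
    ∃ p : MvPolynomial (Fin (n + 1)) k, p.IsHomogeneous d ∧
      MvPolynomial.aeval (zeroCoord f hf) p = a := by
  obtain ⟨p, hp, rfl⟩ := ha
  exact ⟨p, hp, aeval_zeroCoord f hf p⟩

/-- A monomial of positive degree is divisible by some variable. -/
lemma irrelevant_le_span_zeroCoord :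
    (HomogeneousIdeal.irrelevant (zeroGrading f hf)).toIdeal ≤
      Ideal.span (Set.range (zeroCoord f hf)) := by
  rw [HomogeneousIdeal.toIdeal_irrelevant_le]
  intro d hd a ha
  obtain ⟨p, hp, rfl⟩ := exists_aeval_zeroCoord f hf d a ha
  rw [MvPolynomial.aeval_def, MvPolynomial.eval₂_eq]
  refine sum_mem fun e he => Ideal.mul_mem_left _ _ ?_
  have hdeg := hp.degree_eq_sum_deg_support he
  obtain ⟨l, hl⟩ : e.support.Nonempty := by
    rw [Finset.nonempty_iff_ne_empty]
    intro h
    rw [h, Finset.sum_empty] at hdeg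
    omega
  refine Ideal.mem_of_dvd _ (Finset.dvd_prod_of_mem _ hl) ?_
  exact Ideal.pow_mem_of_mem _ (Ideal.subset_span (Set.mem_range_self l)) _
    (Nat.pos_of_ne_zero (Finsupp.mem_support_iff.1 hl))

/-- The inclusion of a standard chart of a zero scheme. -/
def zeroChart (i : Fin (n + 1)) :
    specOver (k := k) (Away (zeroGrading f hf) (zeroCoord f hf i)) ⟶ zeroScheme f hf :=
  Over.homMk (Proj.awayι _ _ (zeroCoord_mem f hf i) zero_lt_one) (by
    have h := Proj.awayι_comp_map (quotientGradedHom (zeroIdeal f hf))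
      (irrelevant_le_map_quotientGradedHom _) zero_lt_one (MvPolynomial.X i)
      (show MvPolynomial.X i ∈ projGrading k n 1 from MvPolynomial.isHomogeneous_X k i)
    change Proj.awayι _ _ (zeroCoord_mem f hf i) zero_lt_one ≫ zeroSchemeInclusion f hf ≫
      Proj.toSpecZero _ ≫ Spec.map _ = Spec.map _
    rw [← Category.assoc, ← Category.assoc]
    refine (congrArg (fun g => (g ≫ Proj.toSpecZero _) ≫ Spec.map _) h).trans ?_
    rw [Category.assoc (Spec.map _), Proj.awayι_toSpecZero, ← Spec.map_comp, ← Spec.map_comp,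
      ← CommRingCat.ofHom_comp, ← CommRingCat.ofHom_comp]
    congr 2)

/-- The description of a zero scheme by its standard charts. -/
def zeroAtlas : ProjectiveAtlas f (zeroScheme f hf) where
  A i := Away (zeroGrading f hf) (zeroCoord f hf i)
  ξ := awayCoord (zeroCoord_mem f hf)
  ξ_self := awayCoord_self _
  aeval_ξ i j := by
    obtain ⟨d, hd⟩ := hf j
    have h : MvPolynomial.aeval (zeroCoord f hf) (f j) = 0 := by
      rw [aeval_zeroCoord]
      exact Ideal.Quotient.eq_zero_iff_mem.2 (Ideal.subset_span ⟨j, rfl⟩)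
    rw [aeval_awayCoord (zeroCoord_mem f hf) i hd (h ▸ zero_mem _)]
    exact HomogeneousLocalization.mk_eq_zero_of_num _ (Subtype.ext h)
  descA i R _ _ x hx h := by
    have hle : ∀ p ∈ (zeroIdeal f hf).toIdeal, MvPolynomial.aeval x p = 0 := by
      have : (zeroIdeal f hf).toIdeal ≤ RingHom.ker (MvPolynomial.aeval (R := k) x) := by
        refine Ideal.span_le.2 ?_
        rintro _ ⟨j, rfl⟩
        exact h j
      exact this
    -- The point `x` kills the equations, so it defines a homomorphism on the coordinate ring; it
    -- sends the i-th coordinate to 1 and hence extends to the chart.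
    let g := Ideal.Quotient.liftₐ (zeroIdeal f hf).toIdeal (MvPolynomial.aeval (R := k) x) hle
    have hg (l) : g (zeroCoord f hf l) = x l := MvPolynomial.aeval_X x l
    have hφ (l) := (awayDesc_awayCoord (zeroCoord_mem f hf) g i ((hg i).trans hx) l).trans (hg l)
    exact ⟨_, hφ, fun ψ hψ => away_hom_ext (zeroCoord_mem f hf) (exists_aeval_zeroCoord f hf) i
      fun l => (hψ l).trans (hφ l).symm⟩
  B i j := Away (zeroGrading f hf) (zeroCoord f hf i * zeroCoord f hf j)
  α i j := awayRestrict (zeroCoord_mem f hf j) rfl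
  β i j := awayRestrict (zeroCoord_mem f hf i) (mul_comm _ _)
  c := awayRatio (zeroCoord_mem f hf)
  β_ξ := awayRestrict_awayCoord _
  descB i j R _ _ a b d h := existsUnique_awayDesc _ (exists_aeval_zeroCoord f hf) i j a b d h
  r := zeroChart f hf
  glue i j := Over.OverMorphism.ext
    ((Proj.SpecMap_awayMap_awayι _ (zeroCoord_mem f hf i) zero_lt_one (zeroCoord_mem f hf j)
      rfl).trans (Proj.SpecMap_awayMap_awayι _ (zeroCoord_mem f hf j) zero_lt_one
        (zeroCoord_mem f hf i) (mul_comm _ _)).symm)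
  univ M b hb := by
    obtain ⟨h, hh, hu⟩ := existsUnique_awayι_comp (zeroCoord_mem f hf)
      (irrelevant_le_span_zeroCoord f hf) (fun i => (b i).left)
      fun i j => congrArg (·.left) (hb i j)
    refine ⟨Over.homMk h ?_, fun i => Over.OverMorphism.ext (hh i), fun h' hh' =>
      Over.OverMorphism.ext (hu _ fun i => congrArg (·.left) (hh' i))⟩
    -- The glued morphism is over `k`: uniqueness of gluing, now with target the base, compares the
    -- two structure morphisms chart by chart.
    refine (existsUnique_awayι_comp (zeroCoord_mem f hf) (irrelevant_le_span_zeroCoord f hf)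
      (fun i => (specOver _).hom) fun i j => ?_).unique (fun i => ?_) fun i =>
        Over.w (zeroChart f hf i)
    · exact (Over.w (specOverMap (awayRestrict (zeroCoord_mem f hf j) rfl))).trans
        (Over.w (specOverMap (awayRestrict (zeroCoord_mem f hf i) (mul_comm _ _)))).symm
    · exact (Category.assoc _ _ _).symm.trans ((congrArg (· ≫ M.hom) (hh i)).trans (Over.w (b i)))

end ZeroScheme

/-! ### The numerical bound -/

lemma ArithmeticCircuit.Computes.one_le_size {k : Type u} [CommSemiring k] {σ : Type w}
    {Γ : ArithmeticCircuit k σ} {f : MvPolynomial σ k} (h : Γ.Computes f) : 1 ≤ Γ.size := by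
  obtain ⟨p, -, b, -⟩ := h
  exact Fintype.card_pos_iff.2 ⟨b⟩

/-- The left side is n² + 16n + 22 + 25N + 3m, and each of n², n, 1, N, m is at most n²N. This gives
67, rounded up to 70. -/
lemma atlas_cost_le {n m N : ℕ} (hn : 1 ≤ n) (hm : 1 ≤ m) (hN : m ≤ N) :
    3 * (4 * (n + 1) + 2 + 8 * N + m) + N + 2 * (n + 1) + (n + 1) * (n + 1) + 1 ≤
      70 * n ^ 2 * N := by
  have h1 : n ≤ n ^ 2 := Nat.le_self_pow two_ne_zero n
  have h2 : n ^ 2 ≤ n ^ 2 * N := Nat.le_mul_of_pos_right _ (hm.trans hN)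
  have h3 : N ≤ n ^ 2 * N := Nat.le_mul_of_pos_left _ (hn.trans h1)
  have h4 : (n + 1) * (n + 1) = n ^ 2 + 2 * n + 1 := by ring
  rw [h4, mul_assoc]
  omega

end

theorem mainTheorem8 :
    ∃ K : ℕ, ∀ (k : Type u) [Field k] (n m : ℕ) (_ : 1 ≤ n) (_ : 1 ≤ m)
      (f : Fin m → MvPolynomial (Fin (n + 1)) k)
      (hf : ∀ i, ∃ d, (f i).IsHomogeneous d)
      (c : Fin m → ℕ)
      (_ : ∀ i, ∃ Γ : ArithmeticCircuit k (Fin (n + 1)), Γ.size = c i ∧ Γ.Computes (f i)),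
      mixedComplexity (BasicMorphism k) (zeroScheme f hf) ≤
        ((K * n ^ 2 * ∑ i, c i : ℕ) : ℕ∞) := by
  refine ⟨70, fun k _ n m hn hm f hf c h => ?_⟩
  obtain ⟨G, hG⟩ := exists_gateSystem f c h
  obtain rfl : (fun j => G.value (G.out j)) = f := funext hG
  -- Each circuit has at least one vertex, so the number of equations is absorbed by the sum of the
  -- sizes.
  have hN : m ≤ ∑ i, c i := by
    have hc (i) : 1 ≤ c i := by
      obtain ⟨Γ, hs, hΓ⟩ := h i
      exact hs ▸ hΓ.one_le_size
    simpa using Finset.sum_le_sum fun i (_ : i ∈ Finset.univ) => hc i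
  exact (zeroAtlas _ hf).mixedComplexity_le.trans (Nat.cast_le.2 (atlas_cost_le hn hm hN))
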